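/- For a simple graph $G$ on $n$ vertices with Laplacian matrix $L(G)$ (degree matrix minus adjacency matrix), define the Laplacian coefficients $c_0(G),\dots,c_n(G)$ by $\det(\lambda I_n-L(G))=\sum_{k=0}^n(-1)^kc_k(G)\lambda^{n-k}$. For graphs $G,H$ on $n$ vertices write $G\preceq H$ if $c_k(G)\le c_k(H)$ for all $0\le k\le n$, and $G\prec H$ if moreover $c_k(G)<c_k(H)$ for some $k$. Let $l\ge 1$ and $n\ge l+3$, and let $\mathcal U_{n,l}^3$ be the set of unicyclic graphs (connected graphs with as many edges as vertices) that have $n$ vertices, exactly $l$ leaves (vertices of degree one) and girth $3$. An element $G$ of $\mathcal U_{n,l}^3$ is called minimal if no $H\in\mathcal U_{n,l}^3$ satisfies $H\prec G$. For $p\ge 0$ with $3+p+l\le n$, let $U_{n,l}^{3,p}$ be the graph on $n$ vertices obtained from a triangle by attaching a path of length $p$ at one of its vertices and then attaching, at the other end of this path (at the same triangle vertex if $p=0$), $l$ pendant paths, each of length $\lfloor (n-3-p)/l\rfloor$ or $\lceil (n-3-p)/l\rceil$, with $n-3-p$ new vertices in total. **Theorem.** Put $p=\max\left\{0,\left\lfloor\frac{n-3-2l}{l+1}\right\rfloor\right\}$.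 Then, up to isomorphism, the minimal elements of $(\mathcal U_{n,l}^3,\preceq)$ are exactly the graphs $U_{n,l}^{3,0},U_{n,l}^{3,1},\dots,U_{n,l}^{3,p}$. If $l\ge 2$, these $p+1$ graphs are pairwise non-isomorphic and pairwise incomparable with respect to $\preceq$, so that there are exactly $p+1$ minimal elements. -/

import Mathlib

/-- The `k`-th Laplacian coefficient `c_k(G)` of a finite simple graph `G` with `N` vertices,
given by `det (λ I - L(G)) = ∑_{k=0}^{N} (-1)^k c_k(G) λ^{N-k}`, where `L(G)` is the Laplacian
matrix (degree matrix minus adjacency matrix); meaningful for `0 ≤ k ≤ N`. -/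
noncomputable def lapCoeff {V : Type*} [Fintype V] [DecidableEq V] (G : SimpleGraph V)
    (k : ℕ) : ℤ :=
  open Classical in
  (-1) ^ k * (G.lapMatrix ℤ).charpoly.coeff (Fintype.card V - k)

/-- `G ≼ H`: every Laplacian coefficient of `G` is at most that of `H`. -/
def LapLE {n : ℕ} (G H : SimpleGraph (Fin n)) : Prop :=
  ∀ k ≤ n, lapCoeff G k ≤ lapCoeff H k

/-- `G ≺ H`: `G ≼ H`, and some Laplacian coefficient of `G` is strictly smaller. -/
def LapLT {n : ℕ} (G H : SimpleGraph (Fin n)) : Prop :=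
  LapLE G H ∧ ∃ k ≤ n, lapCoeff G k < lapCoeff H k

/-- The set of unicyclic graphs (connected, as many edges as vertices) on `n` (labelled) vertices
with exactly `l` leaves (vertices of degree one) and girth `g`. -/
def unicyclicGraphs (n l g : ℕ) : Set (SimpleGraph (Fin n)) :=
  {G | G.Connected ∧ G.edgeSet.ncard = n ∧
    {v : Fin n | (G.neighborSet v).ncard = 1}.ncard = l ∧ G.girth = g}

/-- `G` is a minimal element of the class `S` with respect to `≼`. -/
def IsLapMinimal {n : ℕ} (S : Set (SimpleGraph (Fin n))) (G : SimpleGraph (Fin n)) : Prop :=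
  G ∈ S ∧ ∀ H ∈ S, ¬ LapLT H G

/-- The balanced starlike unicyclic graph `U_{n,l}^{g,p}` (for `3 ≤ g`, `1 ≤ l` and
`g + p + l ≤ n`), with vertices labelled as follows.
* `0, …, g - 1` are the consecutive vertices of the cycle of length `g`.
* `g, …, g + p - 1` are the consecutive further vertices of a path of length `p` that starts at
  the cycle vertex `0`; its other end, the center, is `g + p - 1`, or `0` if `p = 0`.
* The `n - g - p` remaining vertices are dealt out in turn to `l` pendant paths starting at the
  center: the first vertices of these paths are `g + p, …, g + p + l - 1`, and each later vertex
  `v` follows `v - l` on its path.  So the pendant paths have lengths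
  `⌊(n - g - p) / l⌋` or `⌈(n - g - p) / l⌉`: with the center they form
  the balanced starlike tree on `n - g - p + 1` vertices with `l` leaves. -/
def balancedUnicyclic (n l g p : ℕ) : SimpleGraph (Fin n) :=
  SimpleGraph.fromRel fun u v : Fin n =>
    -- the cycle
    (u.val + 1 = v.val ∧ v.val < g) ∨
    (u.val = 0 ∧ v.val + 1 = g) ∨
    -- the path from the cycle to the center
    (v.val = g ∧ 1 ≤ p ∧ u.val = 0) ∨
    (g < v.val ∧ v.val < g + p ∧ u.val + 1 = v.val) ∨
    -- the pendant paths: first vertices, then later vertices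
    (g + p ≤ v.val ∧ v.val < g + p + l ∧ u.val = if p = 0 then 0 else g + p - 1) ∨
    (g + p + l ≤ v.val ∧ u.val + l = v.val)

/-!
# Minimal unicyclic graphs of girth three with respect to the Laplacian coefficients

A connected unicyclic graph of girth three is a triangle with a planted forest hung at each of its
vertices (`SimpleGraph.IsUni.exists_iso_triGraph`), and its Laplacian coefficients are the
coefficients of `det (X + L)` (`SimpleGraph.lapCoeff_eq`). Eliminating the vertices of a forest `F`
from this determinant, from the leaves up, leaves a factor `F.den` and adds the effective
conductance `F.num / F.den` to the diagonal entry of the vertex that carries `F`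
(`SimpleGraph.gDet_hang`). Hence `det (X + L)` is an explicit expression in the polynomials `den`
and `num` of the three forests (`SimpleGraph.lapPoly_triGraph`), all of which have nonnegative
coefficients, and it suffices to compare polynomials coefficientwise.

Each of the following changes keeps the numbers of vertices and leaves and lowers some coefficient,
but raises none; in each case the difference of the determinants is a sum of products of
polynomials with nonnegative coefficients.
* Two forests at different vertices of the triangle are collected at one vertex
  (`Forest.triPoly_merge_lt`). So a minimal graph carries a single forest.
* In a forest, the branches at the end of a path are moved to its top, and the path is continued by
  one of them, or by another path from the top (`Forest.improves_up`, `Forest.improves_down`). By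
  induction, a forest without such an improvement is a broom, a path with a bunch of paths at its
  end (`Forest.improvable_or_broom`).
* The lengths of the paths of the bunch are balanced (`Forest.improves_balance`).
* The handle of the broom is shortened in favour of a bristle, as long as the handle is too long in
  comparison (`Forest.center_move_lt`).

What is left are the balanced starlike graphs of the list, with exactly the stated bound on the
length of the handle (`SimpleGraph.exists_broom_of_minimal`).

Conversely, for `l ≥ 2` one step along the list lowers the coefficient of `X ^ 2`, but raises the
highest coefficient that changes, whose exponent decreases along the list
(`Forest.coeff_broom_succ`); so any two graphs of the list are incomparable. As the class is
finite, a listed graph that is not minimal lies strictly above a minimal graph, which is again in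
the list: this is impossible. For `l = 1` all listed graphs have the same polynomial.
-/

open Polynomial

/-! ### Planted forests and their polynomials -/

/-- A finite ordered planted forest: `nil` is empty, and `cons c rest` has a first tree, whose root
carries the forest `c` of its branches, followed by the trees of `rest`. It is always thought of as
hung below an additional vertex, to which the roots of its trees are joined; so a `Forest` is also
a rooted tree with its root left out. -/
inductive Forest
  | nil : Forest
  | cons (c rest : Forest) : Forest

namespace Forest

/-- The number of vertices; the vertex from which the forest hangs is not counted. -/
def size : Forest → ℕ
  | nil => 0
  | cons c r => c.size + 1 + r.size

/-- The number of vertices without children. -/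
def leaves : Forest → ℕ
  | nil => 0
  | cons c r => max 1 c.leaves + r.leaves

/-- The number of vertices on a longest downward path. -/
def height : Forest → ℕ
  | nil => 0
  | cons c r => max (c.height + 1) r.height

/-- The union of two forests hung at the same vertex. -/
def append : Forest → Forest → Forest
  | nil, G => G
  | cons c r, G => cons c (append r G)

/-- `chain k F` is a downward path of `k` vertices whose last vertex carries `F`; `F` itself if
`k = 0`. -/
def chain : ℕ → Forest → Forest
  | 0, F => F
  | k + 1, F => cons (chain k F) nil

/-- A bunch of paths. An entry `a` stands for a path with `a + 1` vertices, so that every list of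
natural numbers describes paths that are not empty. -/
def paths : List ℕ → Forest
  | [] => nil
  | a :: as => cons (chain a nil) (paths as)

/-- The pair `(den F, num F)`, defined by recursion. Let `T` be the tree formed by `F` and the
vertex from which it hangs. Then `den F` is the determinant of `X + L(T)` without the row and
column of that vertex, and `tot F = X * den F + num F` is the determinant of `X + L(T)`. In terms
of elimination, the Schur complement with respect to the vertices of `F` adds the fraction
`num F / den F`, the effective conductance of `F`, to the diagonal entry of the carrying vertex. -/
noncomputable def polys : Forest → ℤ[X] × ℤ[X]
  | nil => (1, 0)
  | cons c r =>
    (((1 + X) * c.polys.1 + c.polys.2) * r.polys.1,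
      (X * c.polys.1 + c.polys.2) * r.polys.1 + ((1 + X) * c.polys.1 + c.polys.2) * r.polys.2)

/-- The denominator of the effective conductance of `F`; see `polys`. -/
noncomputable def den (F : Forest) : ℤ[X] := F.polys.1
/-- The numerator of the effective conductance of `F`; see `polys`. -/
noncomputable def num (F : Forest) : ℤ[X] := F.polys.2
/-- The determinant of `X + L(T)`, where `T` is the tree formed by `F` and the vertex from which it
hangs. -/
noncomputable def tot (F : Forest) : ℤ[X] := X * F.den + F.num

@[simp] lemma den_nil : den nil = 1 := rfl
@[simp] lemma num_nil : num nil = 0 := rfl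
lemma den_cons (c r : Forest) : den (cons c r) = ((1 + X) * c.den + c.num) * r.den := rfl
lemma num_cons (c r : Forest) : num (cons c r) =
    (X * c.den + c.num) * r.den + ((1 + X) * c.den + c.num) * r.num := rfl

lemma den_append (F G : Forest) : den (F.append G) = F.den * G.den := by
  induction F with
  | nil => simp [append]
  | cons c r _ ih => simp only [append, den_cons, ih]; ring

lemma num_append (F G : Forest) : num (F.append G) = F.num * G.den + F.den * G.num := by
  induction F with
  | nil => simp [append]
  | cons c r _ ih => simp only [append, den_cons, num_cons, ih, den_append]; ring

lemma size_append (F G : Forest) : size (F.append G) = F.size + G.size := by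
  induction F with
  | nil => simp [append, size]
  | cons c r _ ih => simp only [append, size, ih]; ring

lemma leaves_append (F G : Forest) : leaves (F.append G) = F.leaves + G.leaves := by
  induction F with
  | nil => simp [append, leaves]
  | cons c r _ ih => simp only [append, leaves, ih]; ring

lemma leaves_eq_zero {F : Forest} : F.leaves = 0 ↔ F = nil := by
  cases F <;> simp [leaves]

lemma leaves_chain (k : ℕ) {F : Forest} (hF : F ≠ nil) : (chain k F).leaves = F.leaves := by
  have : F.leaves ≠ 0 := fun h => hF (leaves_eq_zero.1 h)
  induction k with
  | zero => rfl
  | succ k ih => simp only [chain, leaves, ih]; omega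

lemma max_leaves_chain_nil (k : ℕ) : max 1 (chain k nil).leaves = 1 := by
  induction k with
  | zero => rfl
  | succ k ih => simp only [chain, leaves, ih]; rfl

lemma size_chain (k : ℕ) (F : Forest) : (chain k F).size = k + F.size := by
  induction k with
  | zero => simp [chain]
  | succ k ih => simp only [chain, size, ih]; omega

lemma leaves_paths (as : List ℕ) : (paths as).leaves = as.length := by
  induction as with
  | nil => rfl
  | cons a as ih => simp only [paths, leaves, ih, max_leaves_chain_nil, List.length_cons]; omega

lemma size_paths (as : List ℕ) : (paths as).size = as.sum + as.length := by
  induction as with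
  | nil => rfl
  | cons a as ih => simp only [paths, size, ih, size_chain, List.length_cons, List.sum_cons]; omega

lemma chain_add (j k : ℕ) (F : Forest) : chain (j + k) F = chain j (chain k F) := by
  induction j with
  | zero => simp [chain]
  | succ j ih => rw [Nat.succ_add]; simp only [chain, ih]

lemma chain_succ (k : ℕ) (F : Forest) : chain (k + 1) F = cons (chain k F) nil := rfl

lemma height_chain_nil (k : ℕ) : (chain k nil).height = k := by
  induction k with
  | zero => rfl
  | succ k ih => simp [chain, height, ih]

lemma height_le_chain (k : ℕ) (F : Forest) : F.height ≤ (chain k F).height := by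
  induction k with
  | zero => rfl
  | succ k ih => simp only [chain, height]; omega

lemma le_height_paths {as : List ℕ} {a : ℕ} (h : a ∈ as) : a + 1 ≤ (paths as).height := by
  induction as with
  | nil => simp at h
  | cons b as ih =>
    simp only [paths, height, height_chain_nil]
    rcases List.mem_cons.1 h with rfl | h
    · omega
    · have := ih h; omega

/-- The denominator of a path with `k` vertices. -/
noncomputable def cd (k : ℕ) : ℤ[X] := den (chain k nil)

/-- The numerator of a path with `k` vertices, divided by `X`; see `num_chain_nil`. -/
noncomputable def cu : ℕ → ℤ[X]
  | 0 => 0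
  | k + 1 => cd k + cu k

@[simp] lemma cd_zero : cd 0 = 1 := rfl
@[simp] lemma cu_zero : cu 0 = 0 := rfl
lemma cu_succ (k : ℕ) : cu (k + 1) = cd k + cu k := rfl

lemma num_chain_nil (k : ℕ) : num (chain k nil) = X * cu k := by
  induction k with
  | zero => simp [chain]
  | succ k ih =>
    simp only [chain, num_cons, ih, cu_succ, cd]
    simp; ring

lemma cd_succ (k : ℕ) : cd (k + 1) = (1 + X) * cd k + X * cu k := by
  simp only [cd, chain, den_cons, num_chain_nil]; simp

/-- A path with `k` vertices acts on the pair `(den, num)` by a matrix, which has determinant one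
by `cd_det`. -/
lemma den_chain (k : ℕ) (F : Forest) : den (chain k F) = cd k * F.den + cu k * F.num ∧
    num (chain k F) = X * cu k * F.den + (cd k - X * cu k) * F.num := by
  induction k with
  | zero => simp [chain]
  | succ k ih =>
    simp only [chain, den_cons, num_cons, ih.1, ih.2, cd_succ, cu_succ]
    constructor <;> (simp; ring)

lemma cd_det (k : ℕ) : cd k * (cd k - X * cu k) - X * cu k ^ 2 = 1 := by
  induction k with
  | zero => simp
  | succ k ih => rw [cd_succ, cu_succ]; linear_combination ih

lemma cd_add (j k : ℕ) : cd (j + k) = cd j * cd k + X * cu j * cu k := by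
  have := (den_chain j (chain k nil)).1
  rw [← chain_add, num_chain_nil] at this
  rw [cd, this, cd, cd]; ring

lemma cu_add (j k : ℕ) : cu (j + k) = cd j * cu k + cu j * (cd k - X * cu k) := by
  induction j with
  | zero => simp
  | succ j ih =>
    rw [Nat.succ_add, cu_succ, ih, cd_add, cd_succ, cu_succ]; ring

/-- All coefficients of `P` are nonnegative. -/
def CNN (P : ℤ[X]) : Prop := ∀ k, 0 ≤ P.coeff k

lemma CNN.add {P Q : ℤ[X]} (hP : CNN P) (hQ : CNN Q) : CNN (P + Q) := fun k => by
  rw [coeff_add]; exact add_nonneg (hP k) (hQ k)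

lemma CNN.mul {P Q : ℤ[X]} (hP : CNN P) (hQ : CNN Q) : CNN (P * Q) := fun k => by
  rw [coeff_mul]; exact Finset.sum_nonneg fun x _ => mul_nonneg (hP _) (hQ _)

lemma CNN.X : CNN X := fun k => by rw [coeff_X]; split_ifs <;> simp
lemma CNN.one : CNN 1 := fun k => by rw [coeff_one]; split_ifs <;> simp
lemma CNN.zero : CNN 0 := fun k => by simp
lemma CNN.ofNat (n : ℕ) : CNN (n : ℤ[X]) := fun k => by
  rw [← C_eq_natCast, coeff_C]; split_ifs <;> simp

lemma CNN.eval_nonneg {P : ℤ[X]} (hP : CNN P) : 0 ≤ P.eval 1 := by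
  rw [eval_eq_sum_range]
  exact Finset.sum_nonneg fun i _ => by simpa using hP i

lemma cnn_den_num (F : Forest) : CNN F.den ∧ CNN F.num := by
  induction F with
  | nil => exact ⟨CNN.one, CNN.zero⟩
  | cons c r hc hr =>
    have h1 := ((CNN.one.add CNN.X).mul hc.1).add hc.2
    exact ⟨h1.mul hr.1, (((CNN.X.mul hc.1).add hc.2).mul hr.1).add (h1.mul hr.2)⟩

lemma cnn_den (F : Forest) : CNN F.den := (cnn_den_num F).1
lemma cnn_num (F : Forest) : CNN F.num := (cnn_den_num F).2
lemma cnn_tot (F : Forest) : CNN F.tot := (CNN.X.mul F.cnn_den).add F.cnn_num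
lemma cnn_cd (k : ℕ) : CNN (cd k) := cnn_den _
lemma cnn_cu (k : ℕ) : CNN (cu k) := by
  induction k with
  | zero => exact CNN.zero
  | succ k ih => exact (cnn_cd k).add ih

lemma eval_den_pos (F : Forest) : 0 < F.den.eval 1 := by
  induction F with
  | nil => simp
  | cons c r hc hr =>
    rw [den_cons]
    have := (cnn_num c).eval_nonneg
    simp only [eval_mul, eval_add, eval_one, eval_X]
    positivity

lemma eval_num_pos {F : Forest} (hF : F ≠ nil) : 0 < F.num.eval 1 := by
  cases F with
  | nil => exact absurd rfl hF
  | cons c r =>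
    have h1 := (cnn_num c).eval_nonneg
    have h2 := (cnn_num r).eval_nonneg
    have h3 := eval_den_pos c
    have h4 := eval_den_pos r
    simp only [num_cons, eval_mul, eval_add, eval_one, eval_X]
    positivity

lemma eval_cd_pos (k : ℕ) : 0 < (cd k).eval 1 := eval_den_pos _
lemma eval_cu_pos (k : ℕ) : 0 < (cu (k + 1)).eval 1 := by
  have h := (cnn_cu k).eval_nonneg
  have := eval_cd_pos k
  rw [cu_succ, eval_add]; positivity

lemma den_ne_zero (F : Forest) : F.den ≠ 0 := fun h => by
  have := eval_den_pos F; simp [h] at this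

/-! ### The coefficientwise order on rooted trees -/

/-- A forest of height at least `m` has at least the effective conductance of a path with `m`
vertices, in the sense that `num F / den F - X * cu m / cd m` has a numerator with nonnegative
coefficients. -/
lemma cnn_dom : ∀ (F : Forest) (m : ℕ), m ≤ F.height → CNN (F.num * cd m - X * cu m * F.den)
  | F, 0, _ => by simpa using F.cnn_num
  | nil, m + 1, h => by simp [height] at h
  | cons c r, m + 1, h => by
    have hc := ((CNN.one.add CNN.X).mul c.cnn_den).add c.cnn_num
    simp only [height] at h
    by_cases h' : m ≤ c.height
    · have := cnn_dom c m h'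
      convert (r.cnn_den.mul this).add ((hc.mul r.cnn_num).mul (cnn_cd (m + 1))) using 1
      rw [den_cons, num_cons, cd_succ, cu_succ]; ring
    · have := cnn_dom r (m + 1) (by omega)
      convert (hc.mul this).add (((CNN.X.mul c.cnn_den).add c.cnn_num).mul
        (r.cnn_den.mul (cnn_cd (m + 1)))) using 1
      rw [den_cons, num_cons]; ring

/-- `F` is replaced by `F'` with advantage: no coefficient of `tot` or `den` grows, and some
coefficient falls. As the differences have nonnegative coefficients, the last condition is
expressed by the sum of their values at `1`. -/
def Improves (F F' : Forest) : Prop :=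
  CNN (F.tot - F'.tot) ∧ CNN (F.den - F'.den) ∧
    0 < (F.tot - F'.tot).eval 1 + (F.den - F'.den).eval 1

lemma den_cons_tot (c r : Forest) : den (cons c r) = (c.tot + c.den) * r.den := by
  rw [den_cons, tot]; ring
lemma tot_cons (c r : Forest) : tot (cons c r) = (c.tot + c.den) * r.tot + c.tot * r.den := by
  rw [tot, den_cons, num_cons, tot, tot]; ring

lemma Improves.cons_left {c c' : Forest} (h : Improves c c') (r : Forest) :
    Improves (cons c r) (cons c' r) := by
  obtain ⟨h1, h2, h3⟩ := h
  have e1 : tot (cons c r) - tot (cons c' r) =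
    ((c.tot - c'.tot) + (c.den - c'.den)) * r.tot + (c.tot - c'.tot) * r.den := by
    rw [tot_cons, tot_cons]; ring
  have e2 : den (cons c r) - den (cons c' r) =
    ((c.tot - c'.tot) + (c.den - c'.den)) * r.den := by
    rw [den_cons_tot, den_cons_tot]; ring
  have c1 := ((h1.add h2).mul r.cnn_tot).add (h1.mul r.cnn_den)
  have c2 := (h1.add h2).mul r.cnn_den
  refine ⟨e1 ▸ c1, e2 ▸ c2, ?_⟩
  have := c1.eval_nonneg
  have h4 := eval_den_pos r
  rw [e1, e2]
  refine add_pos_of_nonneg_of_pos this ?_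
  rw [eval_mul, eval_add]
  positivity

lemma Improves.cons_right {r r' : Forest} (h : Improves r r') (c : Forest) :
    Improves (cons c r) (cons c r') := by
  obtain ⟨h1, h2, h3⟩ := h
  have e1 : tot (cons c r) - tot (cons c r') =
    (c.tot + c.den) * (r.tot - r'.tot) + c.tot * (r.den - r'.den) := by
    rw [tot_cons, tot_cons]; ring
  have e2 : den (cons c r) - den (cons c r') = (c.tot + c.den) * (r.den - r'.den) := by
    rw [den_cons_tot, den_cons_tot]; ring
  have c0 := c.cnn_tot.add c.cnn_den
  refine ⟨e1 ▸ (c0.mul h1).add (c.cnn_tot.mul h2), e2 ▸ c0.mul h2, ?_⟩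
  have h4 := (c.cnn_tot.mul h2).eval_nonneg
  have h5 : 0 < (c.tot + c.den).eval 1 := by
    rw [eval_add]; exact add_pos_of_nonneg_of_pos c.cnn_tot.eval_nonneg (eval_den_pos c)
  rw [e1, e2, eval_add, eval_mul (p := c.tot + c.den) (q := r.tot - r'.tot),
    eval_mul (p := c.tot + c.den) (q := r.den - r'.den)]
  nlinarith [mul_pos h5 h3]

lemma Improves.chain {F F' : Forest} (h : Improves F F') (k : ℕ) :
    Improves (chain k F) (chain k F') := by
  induction k with
  | zero => exact h
  | succ k ih => exact ih.cons_left nil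

/-- A tree starts with a path of `p + 1` vertices, which ends at a vertex `v`, and one of its
branches at `v` is a path with `b + 1` vertices. If the sibling forest `R` has height at least
`b + 1`, then it is an advantage to move the other branches `Y` up from `v` to the vertex from
which everything hangs. -/
lemma improves_up (p b : ℕ) {Y R : Forest} (hY : Y ≠ nil) (hR : b + 1 ≤ R.height) :
    Improves (cons (chain p (cons (chain b nil) Y)) R)
      (cons (chain (p + 1 + b) nil) (Y.append R)) := by
  set F := cons (chain p (cons (chain b nil) Y)) R
  set F' := cons (chain (p + 1 + b) nil) (Y.append R)
  have hF : F = (chain (p + 1) (cons (chain b nil) Y)).append R := rfl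
  have hF' : F' = (chain (p + 1 + (b + 1)) nil).append (Y.append R) := rfl
  have hY' : cons (chain b nil) Y = (chain (b + 1) nil).append Y := rfl
  have e1 : tot F - tot F' = Y.num * cu (p + 1) * (R.num * cd (b + 1) - X * cu (b + 1) * R.den)
      := by
    rw [hF, hF']
    simp only [tot, den_append, num_append, (den_chain _ _).1, (den_chain _ _).2, hY', cd_add (p+1),
      cu_add (p+1), den_nil, num_nil]
    ring
  have e2 : den F - den F' = Y.num * cu (p + 1) * (cd (b + 1) * R.den) := by
    rw [hF, hF']
    simp only [den_append, num_append, (den_chain _ _).1, (den_chain _ _).2, hY', cd_add (p+1),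
      cu_add (p+1), den_nil, num_nil]
    ring
  have c0 := Y.cnn_num.mul (cnn_cu (p + 1))
  have c1 := c0.mul (cnn_dom R (b + 1) hR)
  refine ⟨e1 ▸ c1, e2 ▸ c0.mul ((cnn_cd _).mul R.cnn_den), ?_⟩
  rw [e1, e2]
  refine add_pos_of_nonneg_of_pos c1.eval_nonneg ?_
  simp only [eval_mul]
  have := eval_num_pos hY
  have := eval_cu_pos p
  have := eval_cd_pos (b + 1)
  have := eval_den_pos R
  positivity

/-- A path with `e + 1` vertices hangs beside a tree that starts with a path of `p + 1` vertices
and branches at the end `v` of this path. If some branch `cons c nil` at `v` is at least as high as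
the first path, then it is an advantage to join the two paths and to hang all branches at `v` from
the top. -/
lemma improves_down (p e : ℕ) {c W R : Forest} (hc : e ≤ c.height) (hW : W ≠ nil) :
    Improves (cons (chain e nil) (cons (chain p (cons c W)) R))
      (cons (chain (p + 1 + e) nil) ((cons c W).append R)) := by
  set F := cons (chain e nil) (cons (chain p (cons c W)) R)
  set F' := cons (chain (p + 1 + e) nil) ((cons c W).append R)
  have hF : F = (chain (e + 1) nil).append ((chain (p + 1) (cons c W)).append R) := rfl
  have hF' : F' = (chain (p + 1 + (e + 1)) nil).append ((cons c W).append R) := rfl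
  set V := cons c W with hV
  have e1 : tot F - tot F' = R.num * cu (p + 1) * (V.num * cd (e + 1) - X * cu (e + 1) * V.den)
      := by
    rw [hF, hF']
    simp only [tot, den_append, num_append, (den_chain _ _).1, (den_chain _ _).2, cd_add (p+1),
      cu_add (p+1), den_nil, num_nil]
    ring
  have e2 : den F - den F' = R.den * cu (p + 1) * (V.num * cd (e + 1) - X * cu (e + 1) * V.den)
      := by
    rw [hF, hF']
    simp only [den_append, (den_chain _ _).1, cd_add (p+1),
      cu_add (p+1), den_nil, num_nil]
    ring
  have d0 : CNN (V.num * cd (e + 1) - X * cu (e + 1) * V.den) :=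
    cnn_dom V (e + 1) (by simp only [hV, height]; omega)
  -- strict because the branches `W` contribute in addition to `c`
  have d1 : 0 < (V.num * cd (e + 1) - X * cu (e + 1) * V.den).eval 1 := by
    have : V.num * cd (e + 1) - X * cu (e + 1) * V.den =
        W.den * (c.num * cd e - X * cu e * c.den) +
          (c.tot + c.den) * W.num * cd (e + 1) := by
      rw [hV, den_cons, num_cons, cd_succ, cu_succ, tot]; ring
    rw [this, eval_add]
    refine add_pos_of_nonneg_of_pos (W.cnn_den.mul (cnn_dom c e hc)).eval_nonneg ?_
    have h1 := c.cnn_tot.eval_nonneg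
    have := eval_num_pos hW
    have := eval_cd_pos (e + 1)
    have := eval_den_pos c
    simp only [eval_mul, eval_add]
    positivity
  have c1 := (R.cnn_num.mul (cnn_cu (p + 1))).mul d0
  refine ⟨e1 ▸ c1, e2 ▸ (R.cnn_den.mul (cnn_cu (p + 1))).mul d0, ?_⟩
  rw [e1, e2]
  refine add_pos_of_nonneg_of_pos c1.eval_nonneg ?_
  rw [eval_mul, eval_mul]
  have := eval_cu_pos p
  have := eval_den_pos R
  positivity

/-- Among the paths hanging from one vertex, it is an advantage to shift a vertex from a path to
another one that is shorter by at least two. -/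
lemma improves_balance (b d : ℕ) (R : Forest) :
    Improves (cons (chain (b + d + 2) nil) (cons (chain b nil) R))
      (cons (chain (b + d + 1) nil) (cons (chain (b + 1) nil) R)) := by
  set F := cons (chain (b + d + 2) nil) (cons (chain b nil) R)
  set F' := cons (chain (b + d + 1) nil) (cons (chain (b + 1) nil) R)
  have hF : F = (chain ((b + 1) + (d + 2)) nil).append ((chain (b + 1) nil).append R) := by
    rw [show b + 1 + (d + 2) = b + d + 2 + 1 by omega]; rfl
  have hF' : F' = (chain ((b + 1) + (d + 1)) nil).append ((chain (b + 1 + 1) nil).append R) := by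
    rw [show b + 1 + (d + 1) = b + d + 1 + 1 by omega]; rfl
  have hd := cd_det (b + 1)
  have e1 : tot F - tot F' = X * cu (d + 1) * R.num := by
    rw [hF, hF']
    simp only [tot, den_append, num_append, (den_chain _ _).1, (den_chain _ _).2, cd_add (b+1),
      cu_add (b+1), den_nil, num_nil, cd_succ (d + 1), cu_succ (d + 1), cd_succ 0, cu_succ 0,
      cd_zero, cu_zero]
    linear_combination (X * cu (d + 1) * R.num) * hd
  have e2 : den F - den F' = X * cu (d + 1) * R.den := by
    rw [hF, hF']
    simp only [den_append, (den_chain _ _).1, cd_add (b+1),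
      cu_add (b+1), den_nil, num_nil, cd_succ (d + 1), cu_succ (d + 1), cd_succ 0, cu_succ 0,
      cd_zero, cu_zero]
    linear_combination (X * cu (d + 1) * R.den) * hd
  have c0 := CNN.X.mul (cnn_cu (d + 1))
  refine ⟨e1 ▸ c0.mul R.cnn_num, e2 ▸ c0.mul R.cnn_den, ?_⟩
  rw [e1, e2]
  refine add_pos_of_nonneg_of_pos (c0.mul R.cnn_num).eval_nonneg ?_
  simp only [eval_mul, eval_X]
  have := eval_cu_pos d
  have := eval_den_pos R
  positivity

end Forest

/-! ### Forests that cannot be improved -/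

namespace Forest

/-- Equality of forests up to the order of siblings. -/
inductive Equiv : Forest → Forest → Prop
  | refl (F) : Equiv F F
  | trans {F G H} : Equiv F G → Equiv G H → Equiv F H
  | cons {c c' r r'} : Equiv c c' → Equiv r r' → Equiv (cons c r) (cons c' r')
  | swap (c d r) : Equiv (Forest.cons c (Forest.cons d r)) (Forest.cons d (Forest.cons c r))

lemma Equiv.invariants {F G : Forest} (h : Equiv F G) :
    F.den = G.den ∧ F.num = G.num ∧ F.size = G.size ∧ F.leaves = G.leaves := by
  induction h with
  | refl F => simp
  | trans _ _ h1 h2 =>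
    exact ⟨h1.1.trans h2.1, h1.2.1.trans h2.2.1, h1.2.2.1.trans h2.2.2.1, h1.2.2.2.trans h2.2.2.2⟩
  | cons _ _ h1 h2 =>
    simp only [den_cons, num_cons, size, leaves, h1.1, h1.2.1, h1.2.2.1, h1.2.2.2, h2.1, h2.2.1,
      h2.2.2.1, h2.2.2.2, and_self]
  | swap c d r =>
    simp only [den_cons, num_cons, size, leaves]
    exact ⟨by ring, by ring, by ring, by ring⟩

lemma Equiv.chain {F G : Forest} (h : Equiv F G) (k : ℕ) : Equiv (chain k F) (chain k G) := by
  induction k with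
  | zero => exact h
  | succ k ih => exact ih.cons (.refl _)

lemma Equiv.paths {as bs : List ℕ} (h : as.Perm bs) : Equiv (paths as) (paths bs) := by
  induction h with
  | nil => exact .refl _
  | cons a _ ih => exact (Equiv.refl _).cons ih
  | swap a b l => exact .swap _ _ _
  | trans _ _ h1 h2 => exact h1.trans h2

/-- Some forest with as many vertices and leaves is strictly smaller. -/
def Improvable (F : Forest) : Prop :=
  ∃ F', F'.size = F.size ∧ F'.leaves = F.leaves ∧ Improves F F'

lemma Improvable.of_equiv {F G : Forest} (hG : Improvable G) (h : Equiv F G) : Improvable F := by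
  obtain ⟨F', h1, h2, h3⟩ := hG
  obtain ⟨e1, e2, e3, e4⟩ := h.invariants
  exact ⟨F', h1.trans e3.symm, h2.trans e4.symm, by
    simpa only [Improves, tot, e1, e2] using h3⟩

lemma Improvable.cons_left {c : Forest} (h : Improvable c) (r : Forest) :
    Improvable (cons c r) := by
  obtain ⟨c', h1, h2, h3⟩ := h
  exact ⟨cons c' r, by simp only [size, h1], by simp only [leaves, h2], h3.cons_left r⟩

lemma Improvable.cons_right {r : Forest} (h : Improvable r) (c : Forest) :
    Improvable (cons c r) := by
  obtain ⟨r', h1, h2, h3⟩ := h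
  exact ⟨cons c r', by simp only [size, h1], by simp only [leaves, h2], h3.cons_right c⟩

lemma Improvable.chain {F : Forest} (h : Improvable F) (k : ℕ) : Improvable (chain k F) := by
  induction k with
  | zero => exact h
  | succ k ih => exact ih.cons_left _

lemma improvable_up (p b : ℕ) {Y R : Forest} (hY : Y ≠ nil) (hR : b + 1 ≤ R.height) :
    Improvable (cons (Forest.chain p (cons (Forest.chain b nil) Y)) R) := by
  have hY1 : Y.leaves ≠ 0 := fun h => hY (leaves_eq_zero.1 h)
  refine ⟨_, ?_, ?_, improves_up p b hY hR⟩
  · simp only [size, size_append, size_chain]; omega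
  · simp only [leaves, leaves_append, max_leaves_chain_nil]
    rw [leaves_chain _ (by exact Forest.noConfusion)]
    simp only [leaves, max_leaves_chain_nil]; omega

lemma improvable_down (p e : ℕ) {c W R : Forest} (hc : e ≤ c.height) (hW : W ≠ nil) :
    Improvable (cons (Forest.chain e nil) (cons (Forest.chain p (cons c W)) R)) := by
  refine ⟨_, ?_, ?_, improves_down p e hc hW⟩
  · simp only [size, size_append, size_chain]; omega
  · simp only [leaves, append, leaves_append, max_leaves_chain_nil]
    rw [leaves_chain _ (by exact Forest.noConfusion)]
    simp only [leaves]; omega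

lemma exists_min_perm {as : List ℕ} (h : as ≠ []) :
    ∃ b as', as.Perm (b :: as') ∧ ∀ a ∈ as', b ≤ a := by
  induction as with
  | nil => exact absurd rfl h
  | cons a as ih =>
    by_cases h' : as = []
    · exact ⟨a, as, .refl _, by simp [h']⟩
    · obtain ⟨b, as', h1, h2⟩ := ih h'
      by_cases hab : a ≤ b
      · refine ⟨a, as, .refl _, fun x hx => ?_⟩
        rcases List.mem_cons.1 (h1.subset hx) with rfl | hx
        · exact hab
        · exact hab.trans (h2 x hx)
      · refine ⟨b, a :: as', (h1.cons a).trans (.swap _ _ _), fun x hx => ?_⟩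
        rcases List.mem_cons.1 hx with rfl | hx
        · omega
        · exact h2 x hx

lemma paths_ne_nil {as : List ℕ} (h : as ≠ []) : paths as ≠ nil := by
  cases as with
  | nil => exact absurd rfl h
  | cons a as => exact Forest.noConfusion

/-- A tree that branches below its root path, next to a broom, is improvable: compare the shortest
branch of the tree with the shortest bristle of the broom. If the former is not longer, the tree
opens up by `improvable_up`; otherwise the broom opens up, or, if it is a bunch of paths, its
shortest path is joined to the root path of the tree by `improvable_down`. -/
lemma improvable_branch {p q : ℕ} {as bs : List ℕ} (has : 2 ≤ as.length) (hbs : bs ≠ [])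
    (hq : q = 0 ∨ 2 ≤ bs.length) :
    Improvable (cons (Forest.chain p (paths as)) (Forest.chain q (paths bs))) := by
  obtain ⟨b, as', ha, ha'⟩ := exists_min_perm (as := as) (by rintro rfl; simp at has)
  obtain ⟨e, bs', hb, hb'⟩ := exists_min_perm hbs
  have hal := ha.length_eq
  have hbl := hb.length_eq
  simp only [List.length_cons] at hal hbl
  have has' : as' ≠ [] := by rintro rfl; simp at hal; omega
  have key : Equiv (cons (Forest.chain p (paths as)) (Forest.chain q (paths bs)))
    (cons (Forest.chain p (paths (b :: as'))) (Forest.chain q (paths (e :: bs')))) :=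
    ((Equiv.paths ha).chain p).cons ((Equiv.paths hb).chain q)
  refine Improvable.of_equiv ?_ key
  by_cases hbe : b ≤ e
  · exact improvable_up p b (paths_ne_nil has')
      ((by omega : b + 1 ≤ e + 1).trans ((le_height_paths (by simp)).trans (height_le_chain _ _)))
  · obtain ⟨x, as'', rfl⟩ := List.exists_cons_of_ne_nil has'
    cases q with
    | zero =>
      refine Improvable.of_equiv ?_ (Equiv.swap _ _ _)
      refine improvable_down p e (c := Forest.chain b nil) (W := paths (x :: as'')) ?_
        (paths_ne_nil has')
      rw [height_chain_nil]; omega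
    | succ q =>
      have hbs' : bs' ≠ [] := by rintro rfl; simp at hbl; omega
      refine Improvable.of_equiv ?_ (Equiv.swap _ _ _)
      refine improvable_up q e (paths_ne_nil hbs') ?_
      have h1 : b + 1 ≤ (Forest.chain p (paths (b :: x :: as''))).height :=
        (le_height_paths (by simp)).trans (height_le_chain _ _)
      simp only [height]; omega

/-- A nonempty forest that is not improvable is a broom: a path (the handle) with a bunch of paths
(the bristles) at its end, where the handle is empty unless there are at least two bristles. -/
theorem improvable_or_broom (F : Forest) (hF : F ≠ nil) :
    Improvable F ∨ ∃ p as, Equiv F (Forest.chain p (paths as)) ∧ as ≠ [] ∧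
      (p = 0 ∨ 2 ≤ as.length) := by
  induction F with
  | nil => exact absurd rfl hF
  | cons c r hc hr =>
    -- the branches of the first tree: a path (possibly empty), or a broom with several bristles
    have h1 : Improvable c ∨ (∃ a, Equiv c (Forest.chain a nil)) ∨
        ∃ p as, Equiv c (Forest.chain p (paths as)) ∧ 2 ≤ as.length := by
      by_cases hcn : c = nil
      · exact .inr (.inl ⟨0, hcn ▸ .refl _⟩)
      · rcases hc hcn with h | ⟨p, as, h, hne, hp⟩
        · exact .inl h
        · rcases hp with rfl | hp
          · match as, hne with
            | [a], _ => exact .inr (.inl ⟨a + 1, h⟩)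
            | a :: b :: as, _ => exact .inr (.inr ⟨0, _, h, by simp⟩)
          · exact .inr (.inr ⟨p, as, h, hp⟩)
    by_cases hrn : r = nil
    · subst hrn
      rcases h1 with h | ⟨a, h⟩ | ⟨p, as, h, hp⟩
      · exact .inl (h.cons_left _)
      · exact .inr ⟨0, [a], h.cons (.refl _), by simp, .inl rfl⟩
      · exact .inr ⟨p + 1, as, h.cons (.refl _), by rintro rfl; simp at hp, .inr hp⟩
    · rcases hr hrn with h2 | ⟨q, bs, h2, hbs, hq⟩
      · exact .inl (h2.cons_right _)
      rcases h1 with h | ⟨a, h⟩ | ⟨p, as, h, hp⟩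
      · exact .inl (h.cons_left _)
      · cases q with
        | zero => exact .inr ⟨0, a :: bs, h.cons h2, by simp, .inl rfl⟩
        | succ q =>
          refine .inl (Improvable.of_equiv ?_ ((h.cons h2).trans (.swap _ _ _)))
          exact improvable_branch (q := 0) (bs := [a]) (by omega) (by simp) (.inl rfl)
      · exact .inl (Improvable.of_equiv (improvable_branch hp hbs hq) (h.cons h2))

/-- Any two entries of the list differ by at most one. -/
def Balanced (as : List ℕ) : Prop := ∀ a ∈ as, ∀ b ∈ as, a ≤ b + 1

lemma Balanced.perm {as bs : List ℕ} (h : Balanced as) (hp : as.Perm bs) : Balanced bs :=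
  fun a ha b hb => h a (hp.symm.subset ha) b (hp.symm.subset hb)

lemma improvable_of_not_balanced {as : List ℕ} (h : ¬ Balanced as) : Improvable (paths as) := by
  simp only [Balanced, not_forall, not_le] at h
  obtain ⟨a, ha, b, hb, hab⟩ := h
  have p1 := List.perm_cons_erase ha
  have hb' : b ∈ as.erase a := (List.mem_erase_of_ne (by omega)).2 hb
  have p2 := List.perm_cons_erase hb'
  refine Improvable.of_equiv ?_ (Equiv.paths (p1.trans (p2.cons a)))
  obtain ⟨d, rfl⟩ : ∃ d, a = b + d + 2 := ⟨a - b - 2, by omega⟩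
  refine ⟨_, ?_, ?_, improves_balance b d _⟩
  · simp only [paths, size, size_chain]; omega
  · simp only [paths, leaves, max_leaves_chain_nil]

/-- The least entry of a balanced list is the integral part of the mean. -/
lemma Balanced.min_mul {b : ℕ} {as : List ℕ} (h : Balanced (b :: as)) (hb : ∀ a ∈ as, b ≤ a) :
    b * (as.length + 1) ≤ (b :: as).sum ∧ (b :: as).sum < (b + 1) * (as.length + 1) := by
  have h1 : as.length • b ≤ as.sum := List.card_nsmul_le_sum as b hb
  have h2 : as.sum ≤ as.length • (b + 1) :=
    List.sum_le_card_nsmul as (b + 1) fun a ha => h a (by simp [ha]) b (by simp)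
  simp only [smul_eq_mul] at h1 h2
  rw [List.sum_cons]
  constructor <;> nlinarith

/-- Length and sum determine a balanced list up to order. -/
lemma Balanced.perm_of_sum_eq : ∀ {as bs : List ℕ}, Balanced as → Balanced bs →
    as.length = bs.length → as.sum = bs.sum → as.Perm bs
  | [], bs, _, _, hl, _ => by
    rw [List.eq_nil_of_length_eq_zero (l := bs) (by simpa using hl.symm)]
  | a :: as, bs, ha, hb, hl, hs => by
    obtain ⟨x, as', hx, hx'⟩ := exists_min_perm (as := a :: as) (by simp)
    obtain ⟨y, bs', hy, hy'⟩ := exists_min_perm (as := bs) (by rintro rfl; simp at hl)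
    have hl1 := hx.length_eq
    have hl2 := hy.length_eq
    have s1 := hx.sum_eq
    have s2 := hy.sum_eq
    have ha2 := ha.perm hx
    have hb2 := hb.perm hy
    obtain ⟨m1, m2⟩ := ha2.min_mul hx'
    obtain ⟨m3, m4⟩ := hb2.min_mul hy'
    simp only [List.length_cons, List.sum_cons] at *
    have hll : as'.length = bs'.length := by omega
    have hxy : x = y := by
      rw [hll] at m1 m2
      apply le_antisymm
      · have : x * (bs'.length + 1) < (y + 1) * (bs'.length + 1) := by omega
        exact Nat.lt_succ_iff.1 (lt_of_mul_lt_mul_right this (by omega))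
      · have : y * (bs'.length + 1) < (x + 1) * (bs'.length + 1) := by omega
        exact Nat.lt_succ_iff.1 (lt_of_mul_lt_mul_right this (by omega))
    subst hxy
    have ih : as'.Perm bs' := Balanced.perm_of_sum_eq
      (fun u hu v hv => ha2 u (by simp [hu]) v (by simp [hv]))
      (fun u hu v hv => hb2 u (by simp [hu]) v (by simp [hv])) hll (by omega)
    exact hx.trans ((ih.cons x).trans hy.symm)
termination_by as => as.length
decreasing_by simp_all

lemma Balanced.incr_min {b : ℕ} {as : List ℕ} (h : Balanced (b :: as)) (hb : ∀ a ∈ as, b ≤ a) :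
    Balanced ((b + 1) :: as) := by
  intro u hu v hv
  have h1 := fun w (hw : w ∈ as) => h w (by simp [hw]) b (by simp)
  rcases List.mem_cons.1 hu with rfl | hu' <;> rcases List.mem_cons.1 hv with rfl | hv'
  · omega
  · have := hb v hv'; omega
  · have := h1 u hu'; omega
  · exact h u (by simp [hu']) v (by simp [hv'])

end Forest

/-! ### Triangles with forests: polynomials -/

namespace Forest

/-- The polynomial `det (X + L)` of a triangle with the forests `F`, `G`, `H` hung at its three
vertices; see `SimpleGraph.lapPoly_triGraph`. -/
noncomputable def triPoly (F G H : Forest) : ℤ[X] :=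
  (2 * F.den + F.tot) * (2 * G.den + G.tot) * (2 * H.den + H.tot) - 2 * F.den * G.den * H.den
    - (2 * F.den + F.tot) * G.den * H.den - F.den * (2 * G.den + G.tot) * H.den
    - F.den * G.den * (2 * H.den + H.tot)

/-- The polynomial `det (X + L)` of a triangle with the forest `F` hung at one of its vertices. -/
noncomputable def uniPoly (F : Forest) : ℤ[X] :=
  (X + 1) * (X + 3) * F.tot + 2 * X * (X + 3) * F.den

lemma triPoly_nil_nil (F : Forest) : triPoly F nil nil = uniPoly F := by
  simp only [triPoly, uniPoly, tot, den_nil, num_nil]; ring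

lemma triPoly_swap_left (F G H : Forest) : triPoly F G H = triPoly G F H := by
  simp only [triPoly]; ring

lemma triPoly_swap_right (F G H : Forest) : triPoly F G H = triPoly F H G := by
  simp only [triPoly]; ring

lemma triPoly_merge (F G H : Forest) :
    triPoly F G H - triPoly (F.append G) nil H = F.num * G.num * (2 * H.den + H.tot) := by
  simp only [triPoly, tot, den_nil, num_nil, den_append, num_append]; ring

/-- `P` is coefficientwise at most `Q` and different from `Q`; difference is expressed by the value
of `Q - P` at `1`. -/
def PolyLT (P Q : ℤ[X]) : Prop := CNN (Q - P) ∧ 0 < (Q - P).eval 1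

lemma CNN.two : CNN 2 := by exact_mod_cast CNN.ofNat 2
lemma CNN.three : CNN 3 := by exact_mod_cast CNN.ofNat 3

/-- Collecting two nonempty forests at one vertex of the triangle lowers the polynomial. -/
lemma triPoly_merge_lt {F G : Forest} (hF : F ≠ nil) (hG : G ≠ nil) (H : Forest) :
    PolyLT (triPoly (F.append G) nil H) (triPoly F G H) := by
  rw [PolyLT, triPoly_merge]
  refine ⟨(F.cnn_num.mul G.cnn_num).mul ((CNN.two.mul H.cnn_den).add H.cnn_tot), ?_⟩
  have := eval_num_pos hF
  have := eval_num_pos hG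
  have h1 := eval_den_pos H
  have h2 := H.cnn_tot.eval_nonneg
  simp only [eval_mul, eval_add, eval_ofNat]
  positivity

lemma Improves.uniPoly_lt {F F' : Forest} (h : Improves F F') :
    PolyLT (uniPoly F') (uniPoly F) := by
  obtain ⟨h1, h2, h3⟩ := h
  have e : uniPoly F - uniPoly F' =
      (X + 1) * (X + 3) * (F.tot - F'.tot) + 2 * X * (X + 3) * (F.den - F'.den) := by
    rw [uniPoly, uniPoly]; ring
  have c3 := CNN.X.add CNN.three
  refine ⟨e ▸ (((CNN.X.add CNN.one).mul c3).mul h1).add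
    (((CNN.two.mul CNN.X).mul c3).mul h2), ?_⟩
  rw [e]
  simp only [eval_mul, eval_add, eval_X, eval_one, eval_ofNat]
  nlinarith

/-- The effect on `tot` and `den` of moving the end of the handle of a broom one step up, so that
one vertex of the handle goes to the bristle with `b + 1` vertices. The two changes have opposite
signs, and both are multiples of `Y.num`, where `Y` consists of the other bristles. -/
lemma center_move (p m b : ℕ) (hb : b + 1 = p + m) (Y : Forest) :
    tot (chain (p + 1) (cons (chain b nil) Y)) - tot (chain p (cons (chain (b + 1) nil) Y)) =
      - (Y.num * (X * cu m)) ∧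
    den (chain (p + 1) (cons (chain b nil) Y)) - den (chain p (cons (chain (b + 1) nil) Y)) =
      Y.num * cd m := by
  induction p generalizing m with
  | zero =>
    obtain rfl : m = b + 1 := by omega
    have e1 : cons (chain (b + 1) nil) Y = (chain (b + 1 + 1) nil).append Y := rfl
    have e2 : cons (chain b nil) Y = (chain (b + 1) nil).append Y := rfl
    change tot (cons (cons (chain b nil) Y) nil) - tot (cons (chain (b + 1) nil) Y) = _ ∧
      den (cons (cons (chain b nil) Y) nil) - den (cons (chain (b + 1) nil) Y) = _
    rw [e1, e2]
    simp only [tot, den_cons, num_cons, den_append, num_append, (den_chain _ _).1,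
      (den_chain _ _).2, cd_succ (b + 1), cu_succ (b + 1), den_nil, num_nil]
    constructor <;> ring
  | succ p ih =>
    obtain ⟨i1, i2⟩ := ih (m + 1) (by omega)
    rw [chain_succ (p + 1), chain_succ p (cons (chain (b + 1) nil) Y)]
    simp only [tot_cons, den_cons_tot]
    rw [cd_succ, cu_succ] at *
    simp only [tot, den_nil, num_nil] at *
    constructor
    · linear_combination (1 + X) * i1 + X * i2
    · linear_combination i1 + i2

lemma uniPoly_center_move (p m b : ℕ) (hb : b + 1 = p + m) (Y : Forest) :
    uniPoly (chain (p + 1) (cons (chain b nil) Y)) - uniPoly (chain p (cons (chain (b + 1) nil) Y))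
      = X * (Y.num * ((X + 3) * (2 * cd m - (1 + X) * cu m))) := by
  obtain ⟨h1, h2⟩ := center_move p m b hb Y
  rw [uniPoly, uniPoly]
  linear_combination (X + 1) * (X + 3) * h1 + 2 * X * (X + 3) * h2

/-- If the handle has `p + 1` vertices and some bristle has only `b + 1 ≤ p + 2`, then it is an
advantage to shorten the handle in favour of this bristle. -/
lemma center_move_lt (p b : ℕ) (hb : b ≤ p + 1) {Y : Forest} (hY : Y ≠ nil) :
    PolyLT (uniPoly (chain p (cons (chain (b + 1) nil) Y)))
      (uniPoly (chain (p + 1) (cons (chain b nil) Y))) := by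
  have hpos := eval_num_pos hY
  -- if `b + 1 ≤ p`, the last `b + 2` vertices of the handle suffice: for this shorter handle the
  -- move keeps `tot` and lowers `den`, which is an advantage whatever lies above
  by_cases hbp : b + 1 ≤ p
  · obtain ⟨j, rfl⟩ : ∃ j, p = j + (b + 1) := ⟨p - (b + 1), by omega⟩
    obtain ⟨h1, h2⟩ := center_move (b + 1) 0 b rfl Y
    have e1 := chain_add j (b + 1) (cons (chain (b + 1) nil) Y)
    have e2 := chain_add j (b + 1 + 1) (cons (chain b nil) Y)
    rw [add_assoc j (b + 1) 1, e1, e2]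
    have key : Improves (chain (b + 1 + 1) (cons (chain b nil) Y))
        (chain (b + 1) (cons (chain (b + 1) nil) Y)) := by
      rw [Improves, h1, h2, cu_zero, cd_zero, mul_zero, mul_zero, neg_zero, mul_one]
      exact ⟨CNN.zero, Y.cnn_num, by simpa using hpos⟩
    exact (key.chain j).uniPoly_lt
  · obtain ⟨m, hm⟩ : ∃ m, b + 1 = p + m := ⟨b + 1 - p, by omega⟩
    have key : ∀ Q : ℤ[X], 2 * cd m - (1 + X) * cu m = Q → CNN Q → 0 < Q.eval 1 →
        PolyLT (uniPoly (chain p (cons (chain (b + 1) nil) Y)))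
          (uniPoly (chain (p + 1) (cons (chain b nil) Y))) := by
      intro Q hQ h1 h2
      rw [PolyLT, uniPoly_center_move p m b hm, hQ]
      refine ⟨CNN.X.mul (Y.cnn_num.mul ((CNN.X.add CNN.three).mul h1)), ?_⟩
      simp only [eval_mul, eval_add, eval_X, eval_ofNat]
      positivity
    -- `m ≤ 2` is what makes `2 * cd m - (1 + X) * cu m` coefficientwise nonnegative
    obtain rfl | rfl : m = 1 ∨ m = 2 := by omega
    · refine key (1 + X) ?_ (CNN.one.add CNN.X) (by simp)
      rw [cd_succ, cu_succ, cd_zero, cu_zero]; ring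
    · refine key (X * (X + 3)) ?_ (CNN.X.mul (CNN.X.add CNN.three)) (by simp)
      rw [cd_succ 1, cu_succ 1, cd_succ 0, cu_succ 0, cd_zero, cu_zero]; ring

/-! ### Low and high coefficients -/

lemma coeff_zero_den_num (F : Forest) : F.den.coeff 0 = 1 ∧ F.num.coeff 0 = 0 := by
  induction F with
  | nil => simp
  | cons c r hc hr =>
    simp [den_cons, num_cons, mul_coeff_zero, hc.1, hc.2, hr.1, hr.2]

lemma coeff_one_num (F : Forest) : F.num.coeff 1 = F.size := by
  induction F with
  | nil => simp [size]
  | cons c r hc hr =>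
    simp [num_cons, mul_coeff_one, mul_coeff_zero, coeff_zero_den_num, hc, hr, size]; ring

lemma natDegree_den_num (F : Forest) : F.den.natDegree ≤ F.size ∧ F.num.natDegree ≤ F.size ∧
    F.den.coeff F.size = 1 ∧ 0 ≤ F.num.coeff F.size ∧ (F ≠ nil → 0 < F.num.coeff F.size) := by
  induction F with
  | nil => simp [size]
  | cons c r hc hr =>
    obtain ⟨c1, c2, c3, c4, -⟩ := hc
    obtain ⟨r1, r2, r3, r4, -⟩ := hr
    have a1 : ((1 + X) * c.den + c.num).natDegree ≤ c.size + 1 := by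
      have : ((1 + X : ℤ[X])).natDegree ≤ 1 := by compute_degree
      refine natDegree_add_le_of_degree_le ?_ (by omega)
      exact (natDegree_mul_le).trans (by omega)
    have a2 : (X * c.den + c.num).natDegree ≤ c.size + 1 := by
      refine natDegree_add_le_of_degree_le ?_ (by omega)
      exact (natDegree_mul_le).trans (by rw [natDegree_X]; omega)
    have z1 : c.den.coeff (c.size + 1) = 0 := coeff_eq_zero_of_natDegree_lt (by omega)
    have z2 : c.num.coeff (c.size + 1) = 0 := coeff_eq_zero_of_natDegree_lt (by omega)
    have b1 : ((1 + X) * c.den + c.num).coeff (c.size + 1) = 1 := by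
      rw [add_mul, one_mul, coeff_add, coeff_add, coeff_X_mul, c3, z1, z2]; rfl
    have b2 : (X * c.den + c.num).coeff (c.size + 1) = 1 := by
      rw [coeff_add, coeff_X_mul, c3, z2]; rfl
    have hn : (num (cons c r)).coeff (size (cons c r)) = 1 + r.num.coeff r.size := by
      rw [num_cons, size, coeff_add, coeff_mul_add_eq_of_natDegree_le a2 r1,
        coeff_mul_add_eq_of_natDegree_le a1 r2, b1, b2, r3]; ring
    refine ⟨?_, ?_, ?_, ?_, fun _ => ?_⟩
    · rw [den_cons, size]; exact natDegree_mul_le_of_le a1 r1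
    · rw [num_cons, size]
      exact natDegree_add_le_of_degree_le (natDegree_mul_le_of_le a2 r1)
        (natDegree_mul_le_of_le a1 r2)
    · rw [den_cons, size, coeff_mul_add_eq_of_natDegree_le a1 r1, b1, r3, one_mul]
    · rw [hn]; omega
    · rw [hn]; omega

lemma natDegree_cd (m : ℕ) : (cd m).natDegree ≤ m ∧ (cd m).coeff m = 1 ∧ (cd m).coeff 0 = 1 := by
  have h := natDegree_den_num (chain m nil)
  rw [size_chain] at h
  exact ⟨h.1, h.2.2.1, (coeff_zero_den_num _).1⟩

lemma natDegree_cu (m : ℕ) : (cu (m + 1)).natDegree ≤ m ∧ (cu (m + 1)).coeff m = 1 ∧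
    (cu (m + 1)).coeff 0 = m + 1 := by
  induction m with
  | zero => simp [cu_succ]
  | succ m ih =>
    obtain ⟨h1, h2, h3⟩ := natDegree_cd (m + 1)
    have z : (cu (m + 1)).coeff (m + 1) = 0 := coeff_eq_zero_of_natDegree_lt (by omega)
    rw [cu_succ (m + 1)]
    refine ⟨natDegree_add_le_of_degree_le h1 (by omega), ?_, ?_⟩
    · rw [coeff_add, h2, z]; rfl
    · rw [coeff_add, h3, ih.2.2]; push_cast; ring

lemma coeff_center_factor (m : ℕ) (hm : 1 ≤ m) :
    ((X + 3) * (2 * cd m - (1 + X) * cu m)).natDegree ≤ 1 + m ∧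
    ((X + 3) * (2 * cd m - (1 + X) * cu m)).coeff (1 + m) = 1 ∧
    ((X + 3) * (2 * cd m - (1 + X) * cu m)).coeff 0 = 3 * (2 - (m : ℤ)) := by
  obtain ⟨k, rfl⟩ : ∃ k, m = k + 1 := ⟨m - 1, by omega⟩
  obtain ⟨d1, d2, d3⟩ := natDegree_cd (k + 1)
  obtain ⟨u1, u2, u3⟩ := natDegree_cu k
  have z : (cu (k + 1)).coeff (k + 1) = 0 := coeff_eq_zero_of_natDegree_lt (by omega)
  have a1 : (X + 3 : ℤ[X]).natDegree ≤ 1 := by compute_degree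
  have a2 : (2 * cd (k + 1) - (1 + X) * cu (k + 1)).natDegree ≤ k + 1 := by
    refine (natDegree_sub_le _ _).trans (max_le ?_ ?_)
    · refine natDegree_mul_le.trans ?_
      have : (2 : ℤ[X]).natDegree = 0 := natDegree_ofNat 2
      omega
    · refine natDegree_mul_le.trans ?_
      have : ((1 + X : ℤ[X])).natDegree ≤ 1 := by compute_degree
      omega
  refine ⟨natDegree_mul_le_of_le a1 a2, ?_, ?_⟩
  · have w : (2 * cd (k + 1) - (1 + X) * cu (k + 1)).coeff (k + 1) = 1 := by
      rw [two_mul, add_mul, one_mul, coeff_sub, coeff_add, coeff_add, d2, coeff_X_mul, u2, z]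
      norm_num
    have w' : (X + 3 : ℤ[X]).coeff 1 = 1 := by
      rw [coeff_add, coeff_X_one, coeff_ofNat_succ]; rfl
    rw [coeff_mul_add_eq_of_natDegree_le a1 a2, w, w', one_mul]
  · simp [mul_coeff_zero, d3, u3]

/-- If a bristle with `b + 1` vertices exceeds the handle, of `p + 1` vertices, by at least two,
then moving the end of the handle one step up raises the coefficient of `X ^ 2`, but lowers the
highest coefficient that changes. -/
lemma coeff_center_move (p m b : ℕ) (hb : b + 1 = p + m) (hm : 3 ≤ m) {Y : Forest} (hY : Y ≠ nil)
    {P : ℤ[X]} (hP : P = uniPoly (chain (p + 1) (cons (chain b nil) Y)) -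
      uniPoly (chain p (cons (chain (b + 1) nil) Y))) :
    P.coeff 2 < 0 ∧ 0 < P.coeff (Y.size + m + 2) ∧ ∀ k, Y.size + m + 2 < k → P.coeff k = 0 := by
  rw [uniPoly_center_move p m b hb] at hP
  obtain ⟨f1, f2, f3⟩ := coeff_center_factor m (by omega)
  obtain ⟨-, n1, -, -, n2⟩ := natDegree_den_num Y
  set Q := (X + 3) * (2 * cd m - (1 + X) * cu m)
  have hs : 0 < (Y.size : ℤ) := by
    cases Y with
    | nil => exact absurd rfl hY
    | cons c r => simp only [size]; push_cast; positivity
  subst hP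
  refine ⟨?_, ?_, fun k hk => ?_⟩
  · rw [coeff_X_mul, mul_coeff_one, coeff_one_num, (coeff_zero_den_num Y).2, f3]
    have : (3 : ℤ) ≤ m := by exact_mod_cast hm
    nlinarith
  · rw [coeff_X_mul, show Y.size + m + 1 = Y.size + (1 + m) by ring,
      coeff_mul_add_eq_of_natDegree_le n1 f1, f2, mul_one]
    exact n2 hY
  · obtain ⟨k, rfl⟩ : ∃ j, k = j + 1 := ⟨k - 1, by omega⟩
    rw [coeff_X_mul]
    refine coeff_eq_zero_of_natDegree_lt ?_
    exact (natDegree_mul_le_of_le n1 f1).trans_lt (by omega)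

end Forest

/-! ### Hanging forests on graphs and eliminating them -/

/-- The graph `G` with a new pendant vertex joined to `v`. -/
def SimpleGraph.pend {V : Type*} (G : SimpleGraph V) (v : V) : SimpleGraph (V ⊕ Unit) where
  Adj
    | .inl x, .inl y => G.Adj x y
    | .inl x, .inr _ => x = v
    | .inr _, .inl y => y = v
    | .inr _, .inr _ => False
  symm := ⟨by rintro (x | x) (y | y) h <;> first | exact h.symm | exact h⟩
  loopless := ⟨by rintro (x | x) h <;> simp at h⟩

namespace Forest

/-- The vertices of a forest. -/
inductive Vert : Forest → Type
  | root {c r : Forest} : Vert (cons c r)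
  | child {c r : Forest} (x : Vert c) : Vert (cons c r)
  | rest {c r : Forest} (x : Vert r) : Vert (cons c r)

/-- The parent of a vertex, `none` for the roots of the trees. -/
def par : {F : Forest} → F.Vert → Option F.Vert
  | cons _ _, .root => none
  | cons _ _, .child x => match par x with
    | none => some .root
    | some y => some (.child y)
  | cons _ _, .rest x => (par x).map .rest

instance : IsEmpty (Vert nil) := ⟨nofun⟩

/-- The vertices of `cons c r` are the first root, the vertices of `c` and the vertices of `r`. -/
def vertConsEquiv (c r : Forest) : Vert (cons c r) ≃ Option c.Vert ⊕ r.Vert where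
  toFun
    | .root => .inl none
    | .child x => .inl (some x)
    | .rest x => .inr x
  invFun
    | .inl none => .root
    | .inl (some x) => .child x
    | .inr x => .rest x
  left_inv := by rintro (_ | x | x) <;> rfl
  right_inv := by rintro ((_ | x) | x) <;> rfl

noncomputable instance instFintypeVert : (F : Forest) → Fintype F.Vert
  | nil => Fintype.ofIsEmpty
  | cons c r =>
    have := instFintypeVert c
    have := instFintypeVert r
    Fintype.ofEquiv _ (vertConsEquiv c r).symm

lemma card_vert (F : Forest) : Fintype.card F.Vert = F.size := by
  induction F with
  | nil => simp [size]
  | cons c r hc hr =>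
    rw [Fintype.card_congr (vertConsEquiv c r)]
    simp [hc, hr, size]

section par
variable {c r : Forest}
@[simp] lemma par_root : par (.root : Vert (cons c r)) = none := rfl
@[simp] lemma par_child_ne_none (x : c.Vert) : par (.child x : Vert (cons c r)) ≠ none := by
  rw [par]; split <;> simp
@[simp] lemma par_child_eq_root (x : c.Vert) :
    par (.child x : Vert (cons c r)) = some .root ↔ par x = none := by
  rw [par]; split <;> simp_all
@[simp] lemma par_child_eq_child (x y : c.Vert) :
    par (.child x : Vert (cons c r)) = some (.child y) ↔ par x = some y := by
  rw [par]; split <;> simp_all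
@[simp] lemma par_child_eq_rest (x : c.Vert) (y : r.Vert) :
    par (.child x : Vert (cons c r)) ≠ some (.rest y) := by
  rw [par]; split <;> simp_all
@[simp] lemma par_rest_eq_none (x : r.Vert) :
    par (.rest x : Vert (cons c r)) = none ↔ par x = none := by simp [par]
@[simp] lemma par_rest_eq_root (x : r.Vert) :
    par (.rest x : Vert (cons c r)) ≠ some .root := by simp [par]
@[simp] lemma par_rest_eq_child (x : r.Vert) (y : c.Vert) :
    par (.rest x : Vert (cons c r)) ≠ some (.child y) := by simp [par]
@[simp] lemma par_rest_eq_rest (x y : r.Vert) :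
    par (.rest x : Vert (cons c r)) = some (.rest y) ↔ par x = some y := by simp [par]
end par

/-- The distance of a vertex from the root of its tree. -/
def depth : {F : Forest} → F.Vert → ℕ
  | cons _ _, .root => 0
  | cons _ _, .child x => depth x + 1
  | cons _ _, .rest x => depth x

lemma depth_of_par : ∀ {F : Forest} (x : F.Vert),
    (par x = none → depth x = 0) ∧ ∀ y, par x = some y → depth x = depth y + 1
  | cons c r, .root => by simp [depth]
  | cons c r, .child x => by
    obtain ⟨h1, h2⟩ := depth_of_par x
    refine ⟨by simp, ?_⟩
    rintro (_ | y | y) h <;> simp at h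
    · simp [depth, h1 h]
    · simp [depth, h2 y h]
  | cons c r, .rest x => by
    obtain ⟨h1, h2⟩ := depth_of_par x
    refine ⟨by simpa [depth] using h1, ?_⟩
    rintro (_ | y | y) h <;> simp at h
    simp [depth, h2 y h]

lemma par_ne {F : Forest} (x : F.Vert) : par x ≠ some x := fun h => by
  have := (depth_of_par x).2 x h; omega

end Forest

open Forest

/-- The forest `F` hung at the vertex `v` of `G`: the roots of its trees are joined to `v`. -/
def SimpleGraph.hang {V : Type*} (G : SimpleGraph V) (v : V) (F : Forest) :
    SimpleGraph (V ⊕ F.Vert) where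
  Adj
    | .inl x, .inl y => G.Adj x y
    | .inl x, .inr y => x = v ∧ par y = none
    | .inr y, .inl x => x = v ∧ par y = none
    | .inr y, .inr z => par y = some z ∨ par z = some y
  symm := ⟨by rintro (x | x) (y | y) h <;> first | exact Or.symm h | exact h.symm | exact h⟩
  loopless := ⟨by rintro (x | x) h <;> simp [par_ne] at h⟩

namespace SimpleGraph
variable {V W : Type*} (G : SimpleGraph V) (v : V)

section adj
variable (F : Forest) (x x' : V) (y y' : F.Vert) (u u' : Unit)
@[simp] lemma pend_inl_inl : (G.pend v).Adj (.inl x) (.inl x') ↔ G.Adj x x' := .rfl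
@[simp] lemma pend_inl_inr : (G.pend v).Adj (.inl x) (.inr u) ↔ x = v := .rfl
@[simp] lemma pend_inr_inl : (G.pend v).Adj (.inr u) (.inl x) ↔ x = v := .rfl
@[simp] lemma pend_inr_inr : (G.pend v).Adj (.inr u) (.inr u') ↔ False := .rfl
@[simp] lemma hang_inl_inl : (G.hang v F).Adj (.inl x) (.inl x') ↔ G.Adj x x' := .rfl
@[simp] lemma hang_inl_inr : (G.hang v F).Adj (.inl x) (.inr y) ↔ x = v ∧ par y = none := .rfl
@[simp] lemma hang_inr_inl : (G.hang v F).Adj (.inr y) (.inl x) ↔ x = v ∧ par y = none := .rfl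
@[simp] lemma hang_inr_inr : (G.hang v F).Adj (.inr y) (.inr y') ↔
  par y = some y' ∨ par y' = some y := .rfl
end adj

/-- Hanging the empty forest changes nothing. -/
def hangNil : G.hang v nil ≃g G where
  toEquiv := Equiv.sumEmpty V (Vert nil)
  map_rel_iff' := by
    rintro (x | x) (y | y) <;> first | exact isEmptyElim x | exact isEmptyElim y | rfl

/-- Hanging `cons c r` at `v` amounts to joining a pendant vertex to `v`, hanging `c` at this
vertex and then `r` at `v`. -/
def hangCons (c r : Forest) : G.hang v (cons c r) ≃g
    ((G.pend v).hang (.inr ()) c).hang (.inl (.inl v)) r where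
  toFun
    | .inl x => .inl (.inl (.inl x))
    | .inr .root => .inl (.inl (.inr ()))
    | .inr (.child y) => .inl (.inr y)
    | .inr (.rest z) => .inr z
  invFun
    | .inl (.inl (.inl x)) => .inl x
    | .inl (.inl (.inr _)) => .inr .root
    | .inl (.inr y) => .inr (.child y)
    | .inr z => .inr (.rest z)
  left_inv := by rintro (x | (_ | y | z)) <;> rfl
  right_inv := by rintro (((x | _) | y) | z) <;> rfl
  map_rel_iff' := by
    rintro (x | (_ | y | z)) (x' | (_ | y' | z')) <;> simp

/-- The Laplacian matrix of `G` plus the diagonal matrix of the weights `w`. -/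
noncomputable def wLap {R : Type*} [CommRing R] [Fintype V] (w : V → R) : Matrix V V R :=
  open Classical in
  Matrix.of fun i j => if i = j then w i + ∑ k, if G.Adj i k then 1 else 0
    else if G.Adj i j then -1 else 0

/-- The determinant of the weighted Laplacian matrix `wLap`. -/
noncomputable def gDet {R : Type*} [CommRing R] [Fintype V] (w : V → R) : R :=
  open Classical in (G.wLap w).det

lemma gDet_eq {R : Type*} [CommRing R] [Fintype V] [DecidableEq V] (w : V → R) :
    G.gDet w = (G.wLap w).det := by
  rw [gDet]; congr!

variable {G v} in
lemma gDet_iso {R : Type*} [CommRing R] [Fintype V] [Fintype W] {H : SimpleGraph W} (e : G ≃g H)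
    (w : W → R) : G.gDet (w ∘ e) = H.gDet w := by
  classical
  rw [gDet, gDet, ← Matrix.det_submatrix_equiv_self e.toEquiv]
  congr 1
  · ext i j
    simp only [wLap, Matrix.of_apply, Matrix.submatrix_apply]
    have h1 : ∀ i j, H.Adj (e.toEquiv i) (e.toEquiv j) ↔ G.Adj i j := fun i j => e.map_adj_iff
    have h2 : (∑ k, if H.Adj (e.toEquiv i) k then (1 : R) else 0) =
        ∑ k, if G.Adj i k then 1 else 0 := by
      rw [← e.toEquiv.sum_comp]
      simp only [h1]
    rw [h2]
    simp only [h1, e.toEquiv.injective.eq_iff]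
    rfl

section det
variable {K : Type*} [Field K]

/-- The weights `w` with `x` added to the weight of `v`. -/
noncomputable def addAt {V : Type*} (w : V → K) (v : V) (x : K) : V → K :=
  open Classical in fun i => w i + if i = v then x else 0

/-- Elimination of a pendant vertex of weight `μ`: an edge and an edge of conductance `μ` in series
have conductance `μ / (1 + μ)`. -/
lemma gDet_pend [Fintype V] (w : V → K) (μ : K) (hμ : 1 + μ ≠ 0) :
    (G.pend v).gDet (Sum.elim w fun _ => μ) =
      (1 + μ) * G.gDet (addAt w v (μ / (1 + μ))) := by
  classical
  let D : Matrix Unit Unit K := Matrix.of fun _ _ => 1 + μ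
  let iD : Invertible D := ⟨Matrix.of fun _ _ => (1 + μ)⁻¹,
    by ext i j; simp [D, Matrix.mul_apply, inv_mul_cancel₀ hμ],
    by ext i j; simp [D, Matrix.mul_apply, mul_inv_cancel₀ hμ]⟩
  have hblock : (G.pend v).wLap (Sum.elim w fun _ => μ) =
      Matrix.fromBlocks (G.wLap (addAt w v 1)) (Matrix.of fun i _ => if i = v then -1 else 0)
        (Matrix.of fun _ j => if j = v then -1 else 0) D := by
    ext (i | i) (j | j)
    · by_cases h : i = j
      · subst h
        simp only [wLap, Matrix.of_apply, Matrix.fromBlocks_apply₁₁, if_true, Fintype.sum_sum_type,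
          addAt, Sum.elim_inl]
        simp
        ring
      · simp [wLap, h]
    · simp [wLap]
    · simp [wLap]
    · simp only [wLap, Matrix.of_apply, Fintype.sum_sum_type]
      simp [D, add_comm]
  rw [gDet, gDet, hblock]
  have := Matrix.det_fromBlocks₂₂ (G.wLap (addAt w v 1))
    (Matrix.of fun i (_ : Unit) => if i = v then (-1 : K) else 0)
        (Matrix.of fun (_ : Unit) j => if j = v then -1 else 0) D
  convert this using 2
  · simp [D]
  · congr 1
    ext i j
    have hi : ⅟D = (Matrix.of fun _ _ => (1 + μ)⁻¹) := rfl
    rw [hi]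
    by_cases h : i = j
    · subst h
      by_cases hv : i = v
      · subst hv
        simp [wLap, addAt, Matrix.mul_apply]
        field_simp
        ring
      · simp [wLap, addAt, Matrix.mul_apply, hv]
    · by_cases hv : i = v
      · subst hv; simp [wLap, addAt, Matrix.mul_apply, h, Ne.symm h]
      · simp [wLap, addAt, Matrix.mul_apply, h, hv]

/-- Elimination of a hanging forest all of whose vertices have weight `X`, computed in a field `K`
that contains `ℤ[X]`. -/
lemma gDet_hang (φ : ℤ[X] →+* K) (hφ : Function.Injective φ) (F : Forest) :
    ∀ {V : Type} [Fintype V] (G : SimpleGraph V) (v : V) (w : V → K),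
    (G.hang v F).gDet (Sum.elim w fun _ => φ X) =
      φ F.den * G.gDet (addAt w v (φ F.num / φ F.den)) := by
  classical
  have hne : ∀ F : Forest, φ F.den ≠ 0 := fun F h =>
    F.den_ne_zero (hφ (h.trans (map_zero φ).symm))
  induction F with
  | nil =>
    intro V _ G v w
    rw [← gDet_iso (G.hangNil v).symm]
    simp only [den_nil, num_nil, map_one, map_zero, zero_div, one_mul]
    congr 1
    ext x
    simp [addAt, hangNil]
  | cons c r hc hr =>
    intro V _ G v w
    rw [← gDet_iso (G.hangCons v c r).symm]
    have e0 : (Sum.elim w fun _ => φ X) ∘ (G.hangCons v c r).symm =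
        Sum.elim (Sum.elim (Sum.elim w fun _ => φ X) fun _ => φ X) fun _ => φ X := by
      ext (((x | _) | y) | z) <;> rfl
    have e1 : ∀ x : K, addAt (Sum.elim (Sum.elim w fun (_ : Unit) => φ X) fun (_ : c.Vert) => φ X)
        (.inl (.inl v)) x = Sum.elim (Sum.elim (addAt w v x) fun _ => φ X) fun _ => φ X := by
      intro x
      ext ((x | _) | y) <;> simp [addAt]
    have e2 : ∀ (w : V → K) (x : K), addAt (Sum.elim w fun (_ : Unit) => φ X) (.inr ()) x =
        Sum.elim w fun _ => φ X + x := by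
      intro w x
      ext (x | _) <;> simp [addAt]
    have e6 : ∀ x y : K, addAt (addAt w v x) v y = addAt w v (x + y) := by
      intro x y
      ext i
      by_cases hi : i = v <;> simp [addAt, hi, add_assoc]
    have e3 : φ X + φ c.num / φ c.den = φ (X * c.den + c.num) / φ c.den := by
      rw [map_add, map_mul]; field_simp [hne c]
    have e4 : 1 + (φ X + φ c.num / φ c.den) = φ ((1 + X) * c.den + c.num) / φ c.den := by
      rw [e3, map_add, map_add, map_mul, map_mul, map_add, map_one]; field_simp [hne c]; ring
    have h0 : φ ((1 + X) * c.den + c.num) ≠ 0 := by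
      intro h
      have := hne (cons c nil)
      rw [den_cons, den_nil, mul_one] at this
      exact this h
    rw [e0, hr, e1, hc, e2, gDet_pend _ _ _ _ (by rw [e4]; exact div_ne_zero h0 (hne c)), e4, e3,
      e6]
    -- the branches `c`, seen through the edge to their root, and the rest `r` act in parallel
    have e5 : φ r.num / φ r.den + φ (X * c.den + c.num) / φ c.den /
        (φ ((1 + X) * c.den + c.num) / φ c.den) = φ (cons c r).num / φ (cons c r).den := by
      rw [num_cons, den_cons]
      generalize (1 + X) * c.den + c.num = q at h0
      simp only [map_add, map_mul]
      have := hne c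
      have := hne r
      field_simp
      ring
    rw [e5, den_cons, map_mul]
    have := hne c
    field_simp

end det

/-- The polynomial `det (X + L(G))`, the characteristic polynomial of `L(G)` at `-X` up to sign.
Its coefficients are the Laplacian coefficients; see `lapCoeff_eq`. -/
noncomputable def lapPoly [Fintype V] : ℤ[X] := G.gDet fun _ => X

lemma lapPoly_iso [Fintype V] [Fintype W] {G : SimpleGraph V} {H : SimpleGraph W} (e : G ≃g H) :
    G.lapPoly = H.lapPoly := gDet_iso e fun _ => X

lemma map_lapPoly [Fintype V] {K : Type*} [Field K] (φ : ℤ[X] →+* K) :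
    φ G.lapPoly = G.gDet fun _ => φ X := by
  classical
  rw [lapPoly, gDet, gDet, RingHom.map_det]
  congr 1
  ext i j
  simp only [wLap, RingHom.mapMatrix_apply, Matrix.map_apply, Matrix.of_apply]
  split_ifs <;> simp

/-- The Laplacian coefficient `c_k` is the coefficient of `X ^ (N - k)` in `det (X + L)`. -/
lemma lapCoeff_eq [Fintype V] [DecidableEq V] {k : ℕ} (hk : k ≤ Fintype.card V) :
    lapCoeff G k = G.lapPoly.coeff (Fintype.card V - k) := by
  classical
  have h : ((G.lapMatrix ℤ).charpoly).comp (-X) = (-1) ^ Fintype.card V * G.lapPoly := by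
    rw [Matrix.charpoly, ← coe_compRingHom_apply, RingHom.map_det, lapPoly, gDet_eq,
      ← Matrix.det_neg]
    congr 1
    · ext i j : 2
      by_cases h : i = j
      · subst h
        simp [Matrix.charmatrix, wLap, lapMatrix, degMatrix, adjMatrix, degree_eq_sum_if_adj]
        ring
      · simp [Matrix.charmatrix, wLap, lapMatrix, degMatrix, adjMatrix, h]
        split_ifs <;> simp
  have h' := congrArg (fun P => P.coeff (Fintype.card V - k)) h
  rw [show (-X : ℤ[X]) = C (-1) * X by simp] at h'
  rw [show ((-1 : ℤ[X]) ^ Fintype.card V) = C ((-1) ^ Fintype.card V) by simp] at h'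
  simp only [comp_C_mul_X_coeff, coeff_C_mul] at h'
  obtain ⟨m, hm⟩ := Nat.exists_eq_add_of_le hk
  rw [hm, Nat.add_sub_cancel_left] at h' ⊢
  have h2 : ((-1 : ℤ) ^ m) * (-1) ^ m = 1 := by rw [← mul_pow]; simp
  have h3 : ((-1 : ℤ) ^ k) * (-1) ^ k = 1 := by rw [← mul_pow]; simp
  rw [lapCoeff, hm, Nat.add_sub_cancel_left]
  rw [pow_add] at h'
  linear_combination ((-1) ^ k * (-1) ^ m) * h' -
    ((-1) ^ k * (G.lapMatrix ℤ).charpoly.coeff m) * h2 +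
    G.lapPoly.coeff m * h2 * (-1) ^ k * (-1) ^ k + G.lapPoly.coeff m * h3

end SimpleGraph

/-! ### Triangles with forests: graphs -/

namespace Forest

/-- Case distinction on a vertex, without dependent types. -/
def Vert.elim {α : Type*} {c r : Forest} (a : α) (f : c.Vert → α) (g : r.Vert → α) :
    Vert (cons c r) → α
  | .root => a
  | .child x => f x
  | .rest x => g x

section elim
variable {α : Type*} {c r : Forest} (a : α) (f : c.Vert → α) (g : r.Vert → α)
@[simp] lemma Vert.elim_root : Vert.elim a f g .root = a := rfl
@[simp] lemma Vert.elim_child (x : c.Vert) : Vert.elim a f g (.child x) = f x := rfl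
@[simp] lemma Vert.elim_rest (x : r.Vert) : Vert.elim a f g (.rest x) = g x := rfl
end elim

/-- The forest with a new leaf attached below a given vertex. -/
def addLeaf : (F : Forest) → F.Vert → Forest
  | cons c r, .root => cons (cons nil c) r
  | cons c r, .child x => cons (addLeaf c x) r
  | cons c r, .rest x => cons c (addLeaf r x)

lemma size_addLeaf : ∀ {F : Forest} (z : F.Vert), (F.addLeaf z).size = F.size + 1
  | cons c r, .root => by simp only [addLeaf, size]; omega
  | cons c r, .child x => by simp only [addLeaf, size, size_addLeaf x]; omega
  | cons c r, .rest x => by simp only [addLeaf, size, size_addLeaf x]; omega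

/-- The vertices of `F.addLeaf z` are those of `F`, with their parents, and a new one below `z`. -/
lemma exists_addLeaf_map : ∀ {F : Forest} (z : F.Vert),
    ∃ (f : F.Vert → (F.addLeaf z).Vert) (w : (F.addLeaf z).Vert), f.Injective ∧
      (∀ x, f x ≠ w) ∧ par w = some (f z) ∧ ∀ x, par (f x) = (par x).map f
  | cons c r, .root => by
    rw [addLeaf]
    refine ⟨Vert.elim .root (fun x => .child (.rest x)) (fun x => .rest x),
      .child .root, ?_, ?_, ?_, ?_⟩
    · rintro (_ | x | x) (_ | y | y) h <;> simp_all
    · rintro (_ | x | x) <;> simp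
    · simp
    · rintro (_ | x | x)
      · rfl
      · cases h : par x <;> simp [par, h]
      · cases h : par x <;> simp [par, h]
  | cons c r, .child z => by
    obtain ⟨f, w, h1, h2, h3, h4⟩ := exists_addLeaf_map z
    rw [addLeaf]
    refine ⟨Vert.elim .root (fun x => .child (f x)) (fun x => .rest x),
      .child w, ?_, ?_, ?_, ?_⟩
    · rintro (_ | x | x) (_ | y | y) h <;> simp_all [h1.eq_iff]
    · rintro (_ | x | x) <;> simp [h2]
    · simp [h3]
    · rintro (_ | x | x)
      · rfl
      · cases h : par x <;> simp [par, h4, h]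
      · cases h : par x <;> simp [par, h]
  | cons c r, .rest z => by
    obtain ⟨f, w, h1, h2, h3, h4⟩ := exists_addLeaf_map z
    rw [addLeaf]
    refine ⟨Vert.elim .root (fun x => .child x) (fun x => .rest (f x)),
      .rest w, ?_, ?_, ?_, ?_⟩
    · rintro (_ | x | x) (_ | y | y) h <;> simp_all [h1.eq_iff]
    · rintro (_ | x | x) <;> simp [h2]
    · simp [h3]
    · rintro (_ | x | x)
      · rfl
      · cases h : par x <;> simp [par, h]
      · cases h : par x <;> simp [par, h4, h]

lemma Equiv.exists_map {F G : Forest} (h : Equiv F G) :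
    ∃ f : F.Vert → G.Vert, f.Injective ∧ ∀ x, par (f x) = (par x).map f := by
  induction h with
  | refl F => exact ⟨id, Function.injective_id, by simp⟩
  | trans _ _ h1 h2 =>
    obtain ⟨f, hf, hf'⟩ := h1
    obtain ⟨g, hg, hg'⟩ := h2
    exact ⟨g ∘ f, hg.comp hf, by simp [hf', hg']⟩
  | cons _ _ h1 h2 =>
    obtain ⟨f, hf, hf'⟩ := h1
    obtain ⟨g, hg, hg'⟩ := h2
    refine ⟨Vert.elim .root (fun x => .child (f x)) (fun x => .rest (g x)), ?_, ?_⟩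
    · rintro (_ | x | x) (_ | y | y) h <;> simp_all [hf.eq_iff, hg.eq_iff]
    · rintro (_ | x | x)
      · rfl
      · cases h : par x <;> simp [par, hf', h]
      · cases h : par x <;> simp [par, hg', h]
  | swap c d r =>
    refine ⟨Vert.elim (.rest .root) (fun x => .rest (.child x))
      (Vert.elim .root .child fun x => .rest (.rest x)), ?_, ?_⟩
    · rintro (_ | x | (_ | x | x)) (_ | y | (_ | y | y)) h <;> simp_all
    · rintro (_ | x | (_ | x | x))
      · rfl
      · cases h : par x <;> simp [par, h]
      · rfl
      · cases h : par x <;> simp [par, h]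
      · cases h : par x <;> simp [par, h]

end Forest

namespace SimpleGraph
variable {V W : Type} {G : SimpleGraph V} {v : V} {F F' : Forest}

/-- Hanging a forest respects isomorphisms. -/
def hangCongr {H : SimpleGraph W} (e : G ≃g H) {w : W} (h : e v = w) (F : Forest) :
    G.hang v F ≃g H.hang w F where
  toEquiv := e.toEquiv.sumCongr (.refl _)
  map_rel_iff' := by
    subst h
    rintro (x | x) (y | y) <;> simp
    exact e.map_rel_iff

/-- Joining a pendant vertex respects isomorphisms. -/
def pendCongr {H : SimpleGraph W} (e : G ≃g H) (v : V) : G.pend v ≃g H.pend (e v) where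
  toEquiv := e.toEquiv.sumCongr (.refl _)
  map_rel_iff' := by
    rintro (x | x) (y | y) <;> simp
    exact e.map_rel_iff

lemma hang_equiv (h : Equiv F F') : Nonempty (G.hang v F ≃g G.hang v F') := by
  obtain ⟨f, hf, hf'⟩ := h.exists_map
  have hb : f.Bijective := by
    rw [Fintype.bijective_iff_injective_and_card]
    exact ⟨hf, by rw [card_vert, card_vert, h.invariants.2.2.1]⟩
  refine ⟨⟨(Equiv.refl _).sumCongr (Equiv.ofBijective f hb), ?_⟩⟩
  rintro (x | x) (y | y) <;> simp [hf', hf.eq_iff]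

/-- Hanging a forest at `v` and joining a pendant vertex at a vertex `y` of the base graph
commute. -/
def pendHangInl (y : V) : (G.hang v F).pend (.inl y) ≃g (G.pend y).hang (.inl v) F where
  toFun
    | .inl (.inl x) => .inl (.inl x)
    | .inl (.inr x) => .inr x
    | .inr _ => .inl (.inr ())
  invFun
    | .inl (.inl x) => .inl (.inl x)
    | .inr x => .inl (.inr x)
    | .inl (.inr _) => .inr ()
  left_inv := by rintro ((x | x) | x) <;> rfl
  right_inv := by rintro ((x | x) | x) <;> rfl
  map_rel_iff' := by rintro ((x | x) | x) ((y | y) | y) <;> simp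

/-- A pendant vertex at `v` is a further tree, with one vertex, hung at `v`. -/
def pendHangSelf : (G.hang v F).pend (.inl v) ≃g G.hang v (cons nil F) where
  toFun
    | .inl (.inl x) => .inl x
    | .inl (.inr x) => .inr (.rest x)
    | .inr _ => .inr .root
  invFun
    | .inl x => .inl (.inl x)
    | .inr .root => .inr ()
    | .inr (.child x) => isEmptyElim x
    | .inr (.rest x) => .inl (.inr x)
  left_inv := by rintro ((x | x) | x) <;> rfl
  right_inv := by rintro (x | (_ | x | x)) <;> first | rfl | exact isEmptyElim x
  map_rel_iff' := by rintro ((x | x) | x) ((y | y) | y) <;> simp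

/-- A pendant vertex at a vertex of the hanging forest is a new leaf of the forest. -/
lemma pend_hang_inr (z : F.Vert) :
    ∃ e : (G.hang v F).pend (.inr z) ≃g G.hang v (F.addLeaf z),
      ∀ x, e (.inl (.inl x)) = .inl x := by
  obtain ⟨f, w, h1, h2, h3, h4⟩ := exists_addLeaf_map z
  let f' : F.Vert ⊕ Unit → (F.addLeaf z).Vert := Sum.elim f fun _ => w
  have hf' : f'.Bijective := by
    rw [Fintype.bijective_iff_injective_and_card]
    refine ⟨?_, by simp [card_vert, size_addLeaf]⟩
    rintro (x | x) (y | y) h <;> simp [f', h2, h1.eq_iff, Ne.symm (h2 _)] at h ⊢; exact h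
  refine ⟨⟨(Equiv.sumAssoc _ _ _).trans ((Equiv.refl _).sumCongr (Equiv.ofBijective f' hf')), ?_⟩,
    fun x => rfl⟩
  have h5 : ∀ x y, par (f x) = some (f y) ↔ par x = some y := fun x y => by
    simp [h4, h1.eq_iff]
  have h6 : ∀ x, par (f x) ≠ some w := fun x => by simp [h4, h2]
  have h7 : ∀ x, par (f x) = none ↔ par x = none := fun x => by simp [h4]
  rintro ((x | x) | x) ((y | y) | y) <;> simp [f', h3, h5, h6, h1.eq_iff, h7, eq_comm]

/-- The triangle with three forests hung at its vertices. -/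
def triGraph (F₁ F₂ F₃ : Forest) : SimpleGraph (((Fin 3 ⊕ F₁.Vert) ⊕ F₂.Vert) ⊕ F₃.Vert) :=
  (((⊤ : SimpleGraph (Fin 3)).hang 0 F₁).hang (.inl 1) F₂).hang (.inl (.inl 2)) F₃

/-- A pendant vertex, joined anywhere, leads from a triangle with forests to another one. -/
lemma pend_triGraph (F₁ F₂ F₃ : Forest) (x) :
    ∃ E₁ E₂ E₃, Nonempty ((triGraph F₁ F₂ F₃).pend x ≃g triGraph E₁ E₂ E₃) := by
  rcases x with ((x | z) | z) | z
  · fin_cases x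
    · refine ⟨cons nil F₁, F₂, F₃, ⟨(pendHangInl _).trans (hangCongr ((pendHangInl _).trans
        (hangCongr pendHangSelf ?_ F₂)) ?_ F₃)⟩⟩ <;> rfl
    · refine ⟨F₁, cons nil F₂, F₃, ⟨(pendHangInl _).trans (hangCongr pendHangSelf ?_ F₃)⟩⟩
      rfl
    · exact ⟨F₁, F₂, cons nil F₃, ⟨pendHangSelf⟩⟩
  · obtain ⟨e, he⟩ := pend_hang_inr (G := (⊤ : SimpleGraph (Fin 3))) (v := 0) z
    refine ⟨F₁.addLeaf z, F₂, F₃, ⟨(pendHangInl _).trans (hangCongr ((pendHangInl _).trans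
        (hangCongr e (he _) F₂)) ?_ F₃)⟩⟩
    exact congrArg Sum.inl (he 2)
  · obtain ⟨e, he⟩ := pend_hang_inr (G := (⊤ : SimpleGraph (Fin 3)).hang 0 F₁) (v := .inl 1) z
    exact ⟨F₁, F₂.addLeaf z, F₃, ⟨(pendHangInl _).trans (hangCongr e (he _) F₃)⟩⟩
  · obtain ⟨e, -⟩ := pend_hang_inr (G := ((⊤ : SimpleGraph (Fin 3)).hang 0 F₁).hang (.inl 1) F₂)
      (v := .inl (.inl 2)) z
    exact ⟨F₁, F₂, F₃.addLeaf z, ⟨e⟩⟩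

end SimpleGraph

/-! ### Leaves, edges and girth of triangles with forests -/

namespace Forest

lemma exists_par_eq_none {F : Forest} (hF : F ≠ nil) : ∃ x : F.Vert, par x = none := by
  cases F with
  | nil => exact absurd rfl hF
  | cons c r => exact ⟨.root, rfl⟩

lemma ncard_childless (F : Forest) : {y : F.Vert | ∀ z, par z ≠ some y}.ncard = F.leaves := by
  induction F with
  | nil => rw [Set.eq_empty_of_isEmpty {y : Vert nil | _}, Set.ncard_empty]; rfl
  | cons c r hc hr =>
    have inj1 : Function.Injective (Vert.child : c.Vert → (cons c r).Vert) :=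
      fun x y h => by simpa using h
    have inj2 : Function.Injective (Vert.rest : r.Vert → (cons c r).Vert) :=
      fun x y h => by simpa using h
    have key : {y : (cons c r).Vert | ∀ z, par z ≠ some y} =
        ({y | y = .root ∧ c = nil} ∪ .child '' {y : c.Vert | ∀ z, par z ≠ some y}) ∪
          .rest '' {y : r.Vert | ∀ z, par z ≠ some y} := by
      ext y
      have forall_iff : ∀ P : (cons c r).Vert → Prop,
          (∀ z, P z) ↔ P .root ∧ (∀ z, P (.child z)) ∧ ∀ z, P (.rest z) := fun P =>
        ⟨fun h => ⟨h _, fun _ => h _, fun _ => h _⟩,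
          by rintro ⟨h1, h2, h3⟩ (_ | z | z) <;> simp [*]⟩
      rw [Set.mem_ofPred_eq, forall_iff]
      rcases y with (_ | y | y)
      · simp only [par_root, ne_eq, reduceCtorEq, not_false_eq_true, par_child_eq_root,
          par_rest_eq_root, implies_true, and_true, true_and, Set.mem_union, Set.mem_ofPred_eq,
          Set.mem_image, and_false, exists_false, or_false]
        constructor
        · intro h
          by_contra hne
          obtain ⟨x, hx⟩ := exists_par_eq_none hne
          exact h x hx
        · rintro rfl z
          exact isEmptyElim z
      · simp
      · simp
    rw [key, Set.ncard_union_eq, Set.ncard_union_eq, Set.ncard_image_of_injective _ inj1,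
      Set.ncard_image_of_injective _ inj2, hc, hr, leaves]
    · by_cases h : c = nil
      · subst h; simp [leaves]
      · have : c.leaves ≠ 0 := fun h' => h (leaves_eq_zero.1 h')
        simp [h]; omega
    · rw [Set.disjoint_left]; rintro _ ⟨rfl, -⟩ ⟨x, -, h⟩; simp at h
    · rw [Set.disjoint_left]
      rintro _ (⟨rfl, -⟩ | ⟨x, -, rfl⟩) ⟨y, -, h⟩ <;> simp at h

end Forest

namespace SimpleGraph
variable {V W : Type} {G : SimpleGraph V} {v : V} {F F' : Forest}

lemma gDet_top {R : Type*} [CommRing R] (w : Fin 3 → R) : (⊤ : SimpleGraph (Fin 3)).gDet w =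
    (w 0 + 2) * (w 1 + 2) * (w 2 + 2) - 2 - (w 0 + 2) - (w 1 + 2) - (w 2 + 2) := by
  have h : (⊤ : SimpleGraph (Fin 3)).wLap w =
      !![w 0 + 2, -1, -1; -1, w 1 + 2, -1; -1, -1, w 2 + 2] := by
    ext i j
    fin_cases i <;> fin_cases j <;> simp [wLap, Fin.sum_univ_three] <;> norm_num
  rw [gDet_eq, h, Matrix.det_fin_three]
  simp
  ring

lemma lapPoly_triGraph (F₁ F₂ F₃ : Forest) :
    (triGraph F₁ F₂ F₃).lapPoly = triPoly F₁ F₂ F₃ := by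
  obtain ⟨K, _, φ, hφ⟩ : ∃ (K : Type) (_ : Field K) (φ : ℤ[X] →+* K), Function.Injective φ :=
    ⟨FractionRing ℤ[X], inferInstance, algebraMap _ _, IsFractionRing.injective _ _⟩
  have hne : ∀ F : Forest, φ F.den ≠ 0 := fun F h =>
    F.den_ne_zero (hφ (h.trans (map_zero φ).symm))
  apply hφ
  have e0 : ∀ A B : Type, (fun _ : A ⊕ B => φ X) = Sum.elim (fun _ => φ X) fun _ => φ X := by
    intro A B; ext (x | x) <;> rfl
  have e1 : ∀ {A B : Type} (w : A → K) (a : A) (x : K), addAt (Sum.elim w fun _ : B => φ X)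
      (.inl a) x = Sum.elim (addAt w a x) fun _ => φ X := by
    intro A B w a x
    ext (y | y)
    · by_cases h : y = a <;> simp [addAt, h]
    · simp [addAt]
  rw [map_lapPoly, triGraph, e0, gDet_hang φ hφ, e0, e1, e0, e1, gDet_hang φ hφ, e1,
    gDet_hang φ hφ, gDet_top]
  simp only [addAt, triPoly, tot, map_sub, map_mul, map_add, map_ofNat]
  have h1 := hne F₁
  have h2 := hne F₂
  have h3 := hne F₃
  simp
  field_simp
  ring

/-- The number of leaves, that is, vertices of degree one. -/
noncomputable def leafCount (G : SimpleGraph V) : ℕ := {v : V | (G.neighborSet v).ncard = 1}.ncard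

lemma neighborSet_ncard_iso {H : SimpleGraph W} (e : G ≃g H) (v : V) :
    (H.neighborSet (e v)).ncard = (G.neighborSet v).ncard := by
  rw [← Set.ncard_image_of_injective _ e.injective]
  congr 1
  ext x
  obtain ⟨y, rfl⟩ := e.surjective x
  simpa using e.map_rel_iff

lemma leafCount_iso {H : SimpleGraph W} (e : G ≃g H) : G.leafCount = H.leafCount := by
  rw [leafCount, leafCount, ← Set.ncard_image_of_injective _ e.injective]
  congr 1
  ext x
  obtain ⟨y, rfl⟩ := e.surjective x
  rw [Function.Injective.mem_set_image e.injective]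
  simp only [Set.mem_ofPred_eq, neighborSet_ncard_iso e]

lemma neighborSet_hang_inl_of_ne {x : V} (h : x ≠ v) :
    (G.hang v F).neighborSet (.inl x) = .inl '' G.neighborSet x := by
  ext (y | y) <;> simp [h]

lemma two_le_ncard_hang [Finite V] {x : V} (h : 2 ≤ (G.neighborSet x).ncard) :
    2 ≤ ((G.hang v F).neighborSet (.inl x)).ncard := by
  refine h.trans ?_
  rw [← Set.ncard_image_of_injective _ (Sum.inl_injective (β := F.Vert))]
  refine Set.ncard_le_ncard ?_ (Set.toFinite _)
  rintro _ ⟨y, hy, rfl⟩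
  exact hy

lemma ncard_hang_inr [Finite V] (y : F.Vert) :
    ((G.hang v F).neighborSet (.inr y)).ncard = 1 ↔ ∀ z, par z ≠ some y := by
  -- the parent of `y`
  obtain ⟨q, hq, hq'⟩ : ∃ q, (G.hang v F).Adj (.inr y) q ∧ ∀ z : F.Vert,
      par z = some y → q ≠ .inr z := by
    cases h : par y with
    | none => exact ⟨.inl v, by simp [h], by simp⟩
    | some q =>
      refine ⟨.inr q, by simp [h], ?_⟩
      rintro z hz hqz
      obtain rfl : q = z := by simpa using hqz
      have := (depth_of_par y).2 _ h
      have := (depth_of_par q).2 _ hz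
      omega
  rw [Set.ncard_eq_one]
  constructor
  · rintro ⟨a, ha⟩ z hz
    have h1 : q ∈ (G.hang v F).neighborSet (.inr y) := hq
    have h2 : (.inr z) ∈ (G.hang v F).neighborSet (.inr y) := by simp [hz]
    rw [ha] at h1 h2
    exact hq' z hz (h1.trans h2.symm)
  · intro h
    refine ⟨q, ?_⟩
    ext (x | x)
    · rcases q with (q | q)
      · simp at hq; simp [hq]
      · have : par y = some q := by simpa [h] using hq
        simp [this]
    · rcases q with (q | q)
      · simp at hq; simp [hq, h]
      · have : par y = some q := by simpa [h] using hq
        simp [this, h, eq_comm]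

lemma leafCount_hang [Finite V] (h : 2 ≤ (G.neighborSet v).ncard) :
    (G.hang v F).leafCount = G.leafCount + F.leaves := by
  have key : {x | ((G.hang v F).neighborSet x).ncard = 1} =
      .inl '' {x | (G.neighborSet x).ncard = 1} ∪ .inr '' {y : F.Vert | ∀ z, par z ≠ some y} := by
    ext (x | x)
    · by_cases hx : x = v
      · subst hx
        have := two_le_ncard_hang (v := x) (F := F) h
        simp only [Set.mem_ofPred_eq, Set.mem_union, Set.mem_image, Sum.inl.injEq, exists_eq_right,
          reduceCtorEq, and_false, exists_false, or_false]
        omega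
      · simp [-Set.ncard_eq_one, neighborSet_hang_inl_of_ne hx,
          Set.ncard_image_of_injective _ Sum.inl_injective]
    · simp [-Set.ncard_eq_one, ncard_hang_inr]
  rw [leafCount, key, Set.ncard_union_eq, Set.ncard_image_of_injective _ Sum.inl_injective,
    Set.ncard_image_of_injective _ Sum.inr_injective, ncard_childless, leafCount]
  rw [Set.disjoint_left]; rintro _ ⟨x, -, rfl⟩ ⟨y, -, h⟩; simp at h

lemma leafCount_triGraph (F₁ F₂ F₃ : Forest) :
    (triGraph F₁ F₂ F₃).leafCount = F₁.leaves + F₂.leaves + F₃.leaves := by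
  have h : ∀ i, ((⊤ : SimpleGraph (Fin 3)).neighborSet i).ncard = 2 := by
    intro i
    rw [Set.ncard_eq_toFinset_card']
    simp [Finset.card_compl]
  have h0 : (⊤ : SimpleGraph (Fin 3)).leafCount = 0 := by
    rw [leafCount]; simp only [h]; simp
  rw [triGraph, leafCount_hang (two_le_ncard_hang (two_le_ncard_hang (h 2).ge)),
    leafCount_hang (two_le_ncard_hang (h 1).ge), leafCount_hang (h 0).ge, h0, zero_add]

/-- `G` is connected with as many edges as vertices, and its cycle is a triangle. -/
structure IsUni (G : SimpleGraph V) : Prop where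
  connected : G.Connected
  ncard_edgeSet : G.edgeSet.ncard = Nat.card V
  exists_triangle : ∃ a b c, G.Adj a b ∧ G.Adj b c ∧ G.Adj c a

lemma ncard_edgeSet_iso {H : SimpleGraph W} (e : G ≃g H) : G.edgeSet.ncard = H.edgeSet.ncard :=
  Set.ncard_congr' e.mapEdgeSet

lemma IsUni.iso {H : SimpleGraph W} (h : G.IsUni) (e : G ≃g H) : H.IsUni := by
  refine ⟨e.connected_iff.1 h.1, ?_, ?_⟩
  · rw [← ncard_edgeSet_iso e, h.2, Nat.card_congr e.toEquiv]
  · obtain ⟨a, b, c, h1, h2, h3⟩ := h.3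
    exact ⟨e a, e b, e c, e.map_adj_iff.2 h1, e.map_adj_iff.2 h2, e.map_adj_iff.2 h3⟩

lemma ncard_edgeSet_pend [Finite V] : (G.pend v).edgeSet.ncard = G.edgeSet.ncard + 1 := by
  have key : (G.pend v).edgeSet = insert s(.inl v, .inr ()) (Sym2.map .inl '' G.edgeSet) := by
    ext e
    induction e using Sym2.ind with
    | _ x y =>
      simp only [mem_edgeSet, Set.mem_insert_iff, Set.mem_image, Sym2.exists, Sym2.map_mk]
      rcases x with (x | x) <;> rcases y with (y | y)
      · simp only [pend_inl_inl, Sym2.eq_iff, Sum.inl.injEq, reduceCtorEq, and_false, false_and,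
          or_self, false_or]
        constructor
        · intro h; exact ⟨x, y, h, .inl ⟨rfl, rfl⟩⟩
        · rintro ⟨a, b, h, ⟨rfl, rfl⟩ | ⟨rfl, rfl⟩⟩
          · exact h
          · exact h.symm
      · simp
      · simp
      · simp
  have hinj : Function.Injective (Sym2.map (Sum.inl : V → V ⊕ Unit)) :=
    Sym2.map.injective Sum.inl_injective
  rw [key, Set.ncard_insert_of_notMem _ (Set.toFinite _), Set.ncard_image_of_injective _ hinj]
  rintro ⟨e, -, he⟩
  induction e using Sym2.ind with
  | _ x y => simp at he

lemma IsUni.pend [Finite V] (h : G.IsUni) (v : V) : (G.pend v).IsUni := by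
  refine ⟨?_, ?_, ?_⟩
  · rw [connected_iff_exists_forall_reachable]
    let f : G →g G.pend v := ⟨Sum.inl, fun h => h⟩
    refine ⟨.inl v, ?_⟩
    rintro (x | x)
    · exact (h.1.preconnected v x).map f
    · exact Adj.reachable (by simp)
  · rw [ncard_edgeSet_pend, h.2, Nat.card_sum]; simp
  · obtain ⟨a, b, c, h1, h2, h3⟩ := h.3
    exact ⟨.inl a, .inl b, .inl c, h1, h2, h3⟩

lemma IsUni.hang (F : Forest) : ∀ {V : Type} [Finite V] {G : SimpleGraph V} (_ : G.IsUni) (v : V),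
    (G.hang v F).IsUni := by
  induction F with
  | nil => intro V _ G h v; exact h.iso (G.hangNil v).symm
  | cons c r hc hr =>
    intro V _ G h v
    exact (hr (hc (h.pend v) _) _).iso (G.hangCons v c r).symm

lemma isUni_triGraph (F₁ F₂ F₃ : Forest) : (triGraph F₁ F₂ F₃).IsUni := by
  refine IsUni.hang _ (IsUni.hang _ (IsUni.hang _ ⟨connected_top, ?_, 0, 1, 2, ?_⟩ _) _) _
  · rw [Set.ncard_eq_toFinset_card', ← edgeFinset, card_edgeFinset_top_eq_card_choose_two]
    simp
  · simp

lemma IsUni.girth_eq (h : G.IsUni) : G.girth = 3 := by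
  obtain ⟨a, b, c, h1, h2, h3⟩ := h.3
  have hc : (⊤ : SimpleGraph (Fin 3)) ⊑ G := by
    refine ⟨⟨⟨![a, b, c], ?_⟩, ?_⟩⟩
    · intro i j hij
      fin_cases i <;> fin_cases j <;> simp [h1, h2, h3, h1.symm, h2.symm, h3.symm] at hij ⊢
    · intro i j hij
      fin_cases i <;> fin_cases j <;> simp [h1.ne, h2.ne, h3.ne, h1.ne', h2.ne', h3.ne'] at hij ⊢
  have := hc.egirth_le
  rw [egirth_top (by simp)] at this
  rw [girth, le_antisymm this three_le_egirth]; rfl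

lemma exists_triangle_of_girth (h : G.girth = 3) :
    ∃ a b c, G.Adj a b ∧ G.Adj b c ∧ G.Adj c a := by
  have : ¬ G.IsAcyclic := fun h' => by rw [girth_eq_zero.2 h'] at h; simp at h
  obtain ⟨a, w, -, hw⟩ := exists_girth_eq_length.2 this
  rw [h] at hw
  match w, hw with
  | .cons h1 (.cons h2 (.cons h3 .nil)), _ => exact ⟨_, _, _, h1, h2, h3⟩

end SimpleGraph

/-! ### Unicyclic graphs of girth three are triangles with forests -/

namespace SimpleGraph

/-- The triangle with three empty forests is the complete graph on three vertices. -/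
def triGraphNil : triGraph nil nil nil ≃g (⊤ : SimpleGraph (Fin 3)) :=
  ((hangNil _ _).trans (hangNil _ _)).trans (hangNil _ _)

/-- A graph with a leaf `x` is the graph without `x` with a pendant vertex. -/
lemma exists_iso_pend {V : Type} {G : SimpleGraph V} {x u : V} (hu : G.neighborSet x = {u}) :
    ∃ u' : ({x}ᶜ : Set V), Nonempty ((G.induce {x}ᶜ).pend u' ≃g G) := by
  have hxu : ∀ y, G.Adj x y ↔ y = u := fun y => by
    rw [← mem_neighborSet, hu, Set.mem_singleton_iff]
  have hne : u ∈ ({x}ᶜ : Set V) := ((hxu u).2 rfl).ne'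
  refine ⟨⟨u, hne⟩, ⟨⟨Equiv.ofBijective (Sum.elim Subtype.val fun _ => x) ⟨?_, ?_⟩, ?_⟩⟩⟩
  · rintro (⟨y, hy⟩ | y) (⟨z, hz⟩ | z) h
    · simpa using h
    · exact absurd h hy
    · exact absurd h.symm hz
    · rfl
  · intro y
    by_cases h : y = x
    · exact ⟨.inr (), h.symm⟩
    · exact ⟨.inl ⟨y, h⟩, rfl⟩
  · rintro (⟨y, hy⟩ | y) (⟨z, hz⟩ | z)
    · exact Iff.rfl
    · change G.Adj y x ↔ (⟨y, hy⟩ : ({x}ᶜ : Set V)) = ⟨u, hne⟩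
      rw [adj_comm, hxu, Subtype.mk_eq_mk]
    · change G.Adj x z ↔ (⟨z, hz⟩ : ({x}ᶜ : Set V)) = ⟨u, hne⟩
      rw [hxu, Subtype.mk_eq_mk]
    · change G.Adj x x ↔ False
      simp

/-- Without leaves all degrees are two, as their mean is, and so the triangle is a whole
component. -/
lemma IsUni.exists_iso_top {V : Type} [Finite V] {G : SimpleGraph V} (h : G.IsUni)
    (hleaf : ∀ x, (G.neighborSet x).ncard ≠ 1) : Nonempty ((⊤ : SimpleGraph (Fin 3)) ≃g G) := by
  classical
  have := Fintype.ofFinite V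
  obtain ⟨a, b, c, h1, h2, h3⟩ := h.3
  have : Nontrivial V := ⟨a, b, h1.ne⟩
  have hd : ∀ x, G.degree x = (G.neighborSet x).ncard := fun x => by
    rw [Set.ncard_eq_toFinset_card', ← card_neighborFinset_eq_degree]; rfl
  have hdeg : ∀ x, 2 ≤ G.degree x := fun x => by
    have := h.1.preconnected.degree_pos_of_nontrivial x
    have := hleaf x
    rw [← hd] at this
    omega
  have hsum : ∑ x, G.degree x = ∑ x : V, 2 := by
    rw [sum_degrees_eq_twice_card_edges]
    have := h.2
    rw [Set.ncard_eq_toFinset_card', Nat.card_eq_fintype_card] at this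
    rw [edgeFinset, this]; simp [mul_comm]
  have hdeg2 : ∀ x, G.degree x = 2 := fun x =>
    ((Finset.sum_eq_sum_iff_of_le fun x _ => hdeg x).1 hsum.symm x (Finset.mem_univ _)).symm
  have hnb : ∀ {x y z w}, G.Adj x y → G.Adj x z → y ≠ z → G.Adj x w → w = y ∨ w = z := by
    intro x y z w hy hz hyz hw
    have hsub : ({y, z} : Finset V) ⊆ G.neighborFinset x := by
      intro t ht
      rw [mem_neighborFinset]
      rcases Finset.mem_insert.1 ht with rfl | ht
      · exact hy
      · rw [Finset.mem_singleton.1 ht]; exact hz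
    have := Finset.eq_of_subset_of_card_le hsub (by
      rw [card_neighborFinset_eq_degree, hdeg2, Finset.card_pair hyz])
    have hw' : w ∈ ({y, z} : Finset V) := by rw [this, mem_neighborFinset]; exact hw
    simpa using hw'
  have hclosed : ∀ {x y : V} (w : G.Walk x y),
      (x = a ∨ x = b ∨ x = c) → (y = a ∨ y = b ∨ y = c) := by
    intro x y w
    induction w with
    | nil => exact id
    | cons hadj _ ih =>
      intro hx
      apply ih
      rcases hx with rfl | rfl | rfl
      · rcases hnb h1 h3.symm h2.ne hadj with h | h <;> simp [h]
      · rcases hnb h2 h1.symm h3.ne hadj with h | h <;> simp [h]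
      · rcases hnb h3 h2.symm h1.ne hadj with h | h <;> simp [h]
  refine ⟨⟨Equiv.ofBijective ![a, b, c] ⟨?_, ?_⟩, ?_⟩⟩
  · intro i j hij
    fin_cases i <;> fin_cases j <;> simp [h1.ne, h2.ne, h3.ne, h1.ne', h2.ne', h3.ne'] at hij ⊢
  · intro y
    obtain ⟨w⟩ := h.1.preconnected a y
    rcases hclosed w (.inl rfl) with rfl | rfl | rfl
    · exact ⟨0, rfl⟩
    · exact ⟨1, rfl⟩
    · exact ⟨2, rfl⟩
  · intro i j
    change G.Adj (![a, b, c] i) (![a, b, c] j) ↔ (⊤ : SimpleGraph (Fin 3)).Adj i j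
    fin_cases i <;> fin_cases j <;> simp [h1, h2, h3, h1.symm, h2.symm, h3.symm]

/-- Every connected unicyclic graph with a triangle is a triangle with forests hung at its
vertices, by induction on the number of vertices. -/
theorem IsUni.exists_iso_triGraph : ∀ (n : ℕ) {V : Type} [Finite V] {G : SimpleGraph V}
    (_ : G.IsUni) (_ : Nat.card V = n), ∃ F₁ F₂ F₃, Nonempty (G ≃g triGraph F₁ F₂ F₃) := by
  intro n
  induction n with
  | zero =>
    intro V _ G h hn
    have := h.1.nonempty
    exact absurd hn Nat.card_pos.ne'
  | succ n ih =>
    intro V _ G h hn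
    by_cases hleaf : ∀ x, (G.neighborSet x).ncard ≠ 1
    · obtain ⟨e⟩ := h.exists_iso_top hleaf
      exact ⟨nil, nil, nil, ⟨e.symm.trans triGraphNil.symm⟩⟩
    · classical
      have := Fintype.ofFinite V
      push Not at hleaf
      obtain ⟨x, hx⟩ := hleaf
      obtain ⟨u, hu⟩ := Set.ncard_eq_one.1 hx
      obtain ⟨u', ⟨e⟩⟩ := exists_iso_pend hu
      have hd : G.degree x = 1 := by
        rw [← hx, Set.ncard_eq_toFinset_card', ← card_neighborFinset_eq_degree]; rfl
      have hG' : (G.induce {x}ᶜ).IsUni := by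
        refine ⟨h.1.induce_compl_singleton_of_degree_eq_one hd, ?_, ?_⟩
        · have h1 := ncard_edgeSet_iso e
          rw [ncard_edgeSet_pend, h.2, ← Nat.card_congr e.toEquiv, Nat.card_sum,
            Nat.card_unique (α := Unit)] at h1
          omega
        · obtain ⟨a, b, c, h1, h2, h3⟩ := h.3
          have hne : ∀ {y z}, G.Adj x y → G.Adj x z → y = z := by
            intro y z h1 h2
            rw [← mem_neighborSet, hu, Set.mem_singleton_iff] at h1 h2
            rw [h1, h2]
          have ha : a ≠ x := by rintro rfl; exact h2.ne (hne h1 h3.symm)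
          have hb : b ≠ x := by rintro rfl; exact h3.ne (hne h2 h1.symm)
          have hc : c ≠ x := by rintro rfl; exact h1.ne (hne h3 h2.symm)
          exact ⟨⟨a, ha⟩, ⟨b, hb⟩, ⟨c, hc⟩, h1, h2, h3⟩
      have hcard : Nat.card ({x}ᶜ : Set V) = n := by
        have := Nat.card_congr e.toEquiv
        rw [Nat.card_sum, Nat.card_unique (α := Unit)] at this
        omega
      obtain ⟨F₁, F₂, F₃, ⟨e'⟩⟩ := ih hG' hcard
      obtain ⟨E₁, E₂, E₃, ⟨e''⟩⟩ := pend_triGraph F₁ F₂ F₃ (e' u')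
      exact ⟨E₁, E₂, E₃, ⟨(e.symm.trans (pendCongr e' u')).trans e''⟩⟩

lemma mem_unicyclicGraphs {n l : ℕ} {G : SimpleGraph (Fin n)} :
    G ∈ unicyclicGraphs n l 3 ↔ G.IsUni ∧ G.leafCount = l := by
  constructor
  · rintro ⟨h1, h2, h3, h4⟩
    exact ⟨⟨h1, by simpa using h2, exists_triangle_of_girth h4⟩, h3⟩
  · rintro ⟨h1, h2⟩
    exact ⟨h1.1, by simpa using h1.2, h2, h1.girth_eq⟩

lemma card_triGraph_vert (F₁ F₂ F₃ : Forest) :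
    Fintype.card (((Fin 3 ⊕ F₁.Vert) ⊕ F₂.Vert) ⊕ F₃.Vert) = 3 + F₁.size + F₂.size + F₃.size := by
  simp [card_vert]

/-- The members of the class are triangles with forests; see `mem_of_iso_triGraph` for the
converse. -/
lemma exists_triGraph_of_mem {n l : ℕ} {G : SimpleGraph (Fin n)} (h : G ∈ unicyclicGraphs n l 3) :
    ∃ F₁ F₂ F₃, Nonempty (G ≃g triGraph F₁ F₂ F₃) ∧ 3 + F₁.size + F₂.size + F₃.size = n ∧
      F₁.leaves + F₂.leaves + F₃.leaves = l := by
  obtain ⟨h1, h2⟩ := mem_unicyclicGraphs.1 h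
  obtain ⟨F₁, F₂, F₃, ⟨e⟩⟩ := h1.exists_iso_triGraph n (by simp)
  refine ⟨F₁, F₂, F₃, ⟨e⟩, ?_, ?_⟩
  · rw [← card_triGraph_vert, ← Fintype.card_congr e.toEquiv, Fintype.card_fin]
  · rw [← leafCount_triGraph, ← leafCount_iso e, h2]

lemma mem_of_iso_triGraph {n l : ℕ} {G : SimpleGraph (Fin n)} {F₁ F₂ F₃ : Forest}
    (e : G ≃g triGraph F₁ F₂ F₃) (h : F₁.leaves + F₂.leaves + F₃.leaves = l) :
    G ∈ unicyclicGraphs n l 3 :=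
  mem_unicyclicGraphs.2 ⟨(isUni_triGraph _ _ _).iso e.symm, by
    rw [leafCount_iso e, leafCount_triGraph, h]⟩

lemma exists_iso_fin_triGraph {n : ℕ} {F₁ F₂ F₃ : Forest}
    (h : 3 + F₁.size + F₂.size + F₃.size = n) :
    ∃ G : SimpleGraph (Fin n), Nonempty (G ≃g triGraph F₁ F₂ F₃) := by
  have e := Fintype.equivFinOfCardEq ((card_triGraph_vert F₁ F₂ F₃).trans h)
  exact ⟨(triGraph F₁ F₂ F₃).comap e.symm, ⟨Iso.comap e.symm _⟩⟩

lemma lapCoeff_of_iso {n : ℕ} {G : SimpleGraph (Fin n)} {F₁ F₂ F₃ : Forest}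
    (e : G ≃g triGraph F₁ F₂ F₃) {k : ℕ} (hk : k ≤ n) :
    lapCoeff G k = (triPoly F₁ F₂ F₃).coeff (n - k) := by
  rw [lapCoeff_eq _ (by simpa using hk), lapPoly_iso e, lapPoly_triGraph, Fintype.card_fin]

lemma natDegree_lapPoly {V : Type} [Fintype V] (G : SimpleGraph V) :
    G.lapPoly.natDegree = Fintype.card V := by
  classical
  have h : G.lapPoly = (-(G.lapMatrix ℤ)).charpoly := by
    rw [Matrix.charpoly, lapPoly, gDet_eq]
    congr 1
    ext i j : 2
    by_cases h : i = j
    · subst h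
      simp [Matrix.charmatrix, wLap, lapMatrix, degMatrix, adjMatrix, degree_eq_sum_if_adj]
    · simp [Matrix.charmatrix, wLap, lapMatrix, degMatrix, adjMatrix, h]
      split_ifs <;> simp
  rw [h, Matrix.charpoly_natDegree_eq_dim]

end SimpleGraph

/-! ### Balanced lists of lengths -/

namespace Forest

/-- When `m` vertices are dealt out in turn to `l` paths, path number `k` receives
`partLen l m k + 1` vertices (provided that `l ≤ m`, so that the subtraction is not truncated). -/
def partLen (l m k : ℕ) : ℕ := if k < m % l then m / l else m / l - 1

/-- The lengths, in the encoding of `paths`, of `l` balanced paths with `m` vertices in total. -/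
def balancedParts (l m : ℕ) : List ℕ := (List.range' 0 l).map (partLen l m)

lemma length_balancedParts (l m : ℕ) : (balancedParts l m).length = l := by
  simp [balancedParts]

lemma balanced_balancedParts (l m : ℕ) : Balanced (balancedParts l m) := by
  intro a ha b hb
  simp only [balancedParts, List.mem_map] at ha hb
  obtain ⟨i, -, rfl⟩ := ha
  obtain ⟨j, -, rfl⟩ := hb
  simp only [partLen]
  generalize m / l = q
  split_ifs <;> omega

lemma sum_balancedParts {l m : ℕ} (hl : 1 ≤ l) (hm : l ≤ m) :
    (balancedParts l m).sum + l = m := by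
  have hq : 1 ≤ m / l := (Nat.one_le_div_iff hl).2 hm
  have hr : m % l < l := Nat.mod_lt _ hl
  have h1 : (balancedParts l m).sum = ∑ k ∈ Finset.range l, partLen l m k := by
    rw [balancedParts, ← List.range_eq_range']; rfl
  have h2 : ∀ k, partLen l m k = (m / l - 1) + if k < m % l then 1 else 0 := by
    intro k; simp only [partLen]; split_ifs <;> omega
  have h3 : (∑ k ∈ Finset.range l, if k < m % l then 1 else 0) = m % l := by
    rw [← Finset.sum_filter, Finset.sum_const, smul_eq_mul, mul_one]
    have : Finset.filter (fun k => k < m % l) (Finset.range l) = Finset.range (m % l) := by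
      ext k; simp; omega
    rw [this, Finset.card_range]
  rw [h1, Finset.sum_congr rfl fun k _ => h2 k, Finset.sum_add_distrib, h3, Finset.sum_const,
    Finset.card_range, smul_eq_mul]
  have := Nat.div_add_mod m l
  obtain ⟨q, hq'⟩ : ∃ q, m / l = q + 1 := ⟨m / l - 1, by omega⟩
  rw [hq'] at this ⊢
  simp only [Nat.add_sub_cancel]
  linarith

lemma partLen_lt {l m k : ℕ} (hm : l ≤ m) (hk : k < l) : k + l * partLen l m k < m := by
  have hq : 1 ≤ m / l := (Nat.one_le_div_iff (by omega)).2 hm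
  have := Nat.div_add_mod m l
  obtain ⟨q, hq'⟩ : ∃ q, m / l = q + 1 := ⟨m / l - 1, by omega⟩
  rw [partLen]
  rw [hq'] at this ⊢
  split_ifs
  · omega
  · simp only [Nat.add_sub_cancel]
    rw [mul_add] at this
    omega

/-! ### The labelling of the balanced starlike unicyclic graphs -/

/-- The labels on `chain p F`: `s, s + 1, …` down the path, and `g` on `F`. -/
def chainLabel {F : Forest} (g : F.Vert → ℕ) : (p s : ℕ) → (chain p F).Vert → ℕ
  | 0, _ => g
  | p + 1, s => Vert.elim s (chainLabel g p (s + 1)) isEmptyElim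

/-- The labels on paths number `k, k + 1, …` of a bunch: `s + k` at the top of path number `k`,
with steps of `l` down each path. -/
def pathsLabel (l s : ℕ) : (k : ℕ) → (as : List ℕ) → (paths as).Vert → ℕ
  | _, [] => fun x : Vert nil => isEmptyElim x
  | k, _ :: as => Vert.elim (s + k) (fun x => s + k + l * (depth x + 1)) (pathsLabel l s (k + 1) as)

lemma depth_lt_of_chain : ∀ (a : ℕ) (x : (chain a nil).Vert), depth x < a
  | 0, (x : Vert nil) => isEmptyElim x
  | a + 1, .root => Nat.succ_pos a
  | a + 1, .child x => Nat.succ_lt_succ (depth_lt_of_chain a x)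
  | a + 1, .rest x => isEmptyElim x

lemma depth_injective_of_chain : ∀ (a : ℕ) {x y : (chain a nil).Vert}, depth x = depth y → x = y
  | 0, (x : Vert nil), _, _ => isEmptyElim x
  | a + 1, .root, .root, _ => rfl
  | _ + 1, .root, .child _, h => absurd h (Nat.succ_ne_zero _).symm
  | _ + 1, .child _, .root, h => absurd h (Nat.succ_ne_zero _)
  | a + 1, .child _, .child _, h =>
    congrArg Vert.child (depth_injective_of_chain a (Nat.succ.inj h))
  | a + 1, .rest x, _, _ => isEmptyElim x
  | a + 1, _, .rest x, _ => isEmptyElim x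

/-- The labels of a bunch of paths are distinct and below `s + m`, the roots have the labels
`s + i` with `i < l`, and the label of any other vertex exceeds that of its parent by `l`. The
residue of a label modulo `l` tells the paths apart. -/
lemma pathsLabel_spec (l s : ℕ) (f : ℕ → ℕ) (m : ℕ) (hf : ∀ k < l, k + l * f k < m) :
    ∀ (c k : ℕ), k + c ≤ l →
      Function.Injective (pathsLabel l s k ((List.range' k c).map f)) ∧
      (∀ x, ∃ i j, k ≤ i ∧ i < l ∧ pathsLabel l s k ((List.range' k c).map f) x = s + i + l * j ∧
        i + l * j < m ∧ (par x = none → j = 0) ∧ ∀ y, par x = some y → ∃ j', j = j' + 1 ∧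
          pathsLabel l s k ((List.range' k c).map f) y = s + i + l * j') := by
  intro c
  induction c with
  | zero =>
    intro k _
    exact ⟨fun (x : Vert nil) => isEmptyElim x, fun (x : Vert nil) => isEmptyElim x⟩
  | succ c ih =>
    intro k hk
    obtain ⟨ih1, ih2⟩ := ih (k + 1) (by omega)
    rw [List.range'_succ, List.map_cons]
    set as := (List.range' (k + 1) c).map f
    -- labels on the other paths are in larger residue classes
    have hres : ∀ x j, pathsLabel l s (k + 1) as x ≠ s + k + l * j := by
      intro x j h
      obtain ⟨i, j', h1, h2, h3, -⟩ := ih2 x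
      rw [h3] at h
      have h4 : (i + l * j') % l = (k + l * j) % l := by congr 1; omega
      rw [Nat.add_mul_mod_self_left, Nat.add_mul_mod_self_left, Nat.mod_eq_of_lt h2,
        Nat.mod_eq_of_lt (by omega)] at h4
      omega
    have hl : 0 < l := by omega
    constructor
    · rintro (_ | x | x) (_ | y | y) h
      · rfl
      · simp [pathsLabel] at h; omega
      · exact absurd h.symm (by simpa [pathsLabel] using hres y 0)
      · simp [pathsLabel] at h; omega
      · simp only [pathsLabel, Vert.elim_child, Nat.add_left_cancel_iff] at h
        have := Nat.eq_of_mul_eq_mul_left hl h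
        rw [depth_injective_of_chain _ (x := x) (y := y) (by omega)]
      · exact absurd h.symm (by simpa [pathsLabel] using hres y (depth x + 1))
      · exact absurd h (by simpa [pathsLabel] using hres x 0)
      · exact absurd h (by simpa [pathsLabel] using hres x (depth y + 1))
      · rw [ih1 (show pathsLabel l s (k + 1) as x = pathsLabel l s (k + 1) as y from h)]
    · rintro (_ | x | x)
      · have := hf k (by omega)
        exact ⟨k, 0, le_rfl, by omega, rfl, by omega, fun _ => rfl, fun y hy => by cases hy⟩
      · refine ⟨k, depth x + 1, le_rfl, by omega, rfl, ?_,
          fun h => absurd h (par_child_ne_none x), ?_⟩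
        · have h1 := hf k (by omega)
          have h2 := depth_lt_of_chain _ x
          have : l * (depth x + 1) ≤ l * f k := Nat.mul_le_mul_left _ h2
          omega
        · rintro (_ | y | y) hy
          · refine ⟨0, ?_, rfl⟩
            have : par x = none := (par_child_eq_root x).1 hy
            rw [(depth_of_par x).1 this]
          · refine ⟨depth y + 1, ?_, rfl⟩
            have : par x = some y := (par_child_eq_child x y).1 hy
            rw [(depth_of_par x).2 _ this]
          · exact absurd hy (par_child_eq_rest x y)
      · obtain ⟨i, j, h1, h2, h3, h4, h5, h6⟩ := ih2 x
        refine ⟨i, j, by omega, h2, h3, h4, fun h => h5 ((par_rest_eq_none x).1 h), ?_⟩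
        rintro (_ | y | y) hy
        · exact absurd hy (par_rest_eq_root x)
        · exact absurd hy (par_rest_eq_child x y)
        · exact h6 y ((par_rest_eq_rest x y).1 hy)

/-- The label of the parent of the vertex labelled `v ≥ 3` in `balancedUnicyclic n l 3 p`, where
the cycle vertex `0` counts as the parent of the vertices of the forest that are joined to it. -/
def labelPar (l p v : ℕ) : ℕ :=
  if v < 3 + p then (if v = 3 then 0 else v - 1)
  else if v < 3 + p + l then (if p = 0 then 0 else 2 + p)
  else v - l

/-- If the labels `g` on `F` are correct for a forest that hangs from the end of the path of length
`p`, then so are the labels on the chain with `F` at its end. -/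
lemma chainLabel_spec {F : Forest} (g : F.Vert → ℕ) (l p n : ℕ) (hg : Function.Injective g)
    (hgl : ∀ x, 3 + p ≤ g x) (hgn : ∀ x, g x < n) (hn : 3 + p ≤ n)
    (hnone : ∀ x, par x = none → labelPar l p (g x) = if p = 0 then 0 else 2 + p)
    (hsome : ∀ x y, par x = some y → labelPar l p (g x) = g y) :
    ∀ (q s : ℕ), 3 ≤ s → s + q = 3 + p →
      Function.Injective (chainLabel g q s) ∧ (∀ x, s ≤ chainLabel g q s x) ∧
      (∀ x, chainLabel g q s x < n) ∧
      (∀ x, par x = none → labelPar l p (chainLabel g q s x) = if s = 3 then 0 else s - 1) ∧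
      (∀ x y, par x = some y → labelPar l p (chainLabel g q s x) = chainLabel g q s y) := by
  intro q
  induction q with
  | zero =>
    intro s hs hsq
    obtain rfl : s = 3 + p := hsq
    refine ⟨hg, hgl, hgn, fun x hx => (hnone x hx).trans ?_, hsome⟩
    split_ifs <;> omega
  | succ q ih =>
    intro s hs hsq
    obtain ⟨h1, h2, h3, h4, h5⟩ := ih (s + 1) (by omega) (by omega)
    refine ⟨?_, ?_, ?_, ?_, ?_⟩
    · rintro (_ | x | x) (_ | y | y) h
      · rfl
      · have : s = chainLabel g q (s + 1) y := h
        have := h2 y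
        omega
      · exact isEmptyElim y
      · have : chainLabel g q (s + 1) x = s := h
        have := h2 x
        omega
      · exact congrArg Vert.child (h1 h)
      · exact isEmptyElim y
      all_goals exact isEmptyElim x
    · rintro (_ | x | x)
      · exact le_rfl
      · exact (Nat.le_succ s).trans (h2 x)
      · exact isEmptyElim x
    · rintro (_ | x | x)
      · have : s < n := by omega
        exact this
      · exact h3 x
      · exact isEmptyElim x
    · rintro (_ | x | x) hx
      · have : s < 3 + p := by omega
        exact if_pos this
      · exact absurd hx (par_child_ne_none x)
      · exact isEmptyElim x
    · rintro (_ | x | x) (_ | y | y) hxy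
      · cases hxy
      · cases hxy
      · cases hxy
      · exact (h4 x ((par_child_eq_root x).1 hxy)).trans (if_neg (by omega))
      · exact h5 x y ((par_child_eq_child x y).1 hxy)
      · exact isEmptyElim y
      all_goals exact isEmptyElim x

end Forest

namespace SimpleGraph

/-- The graph `balancedUnicyclic n l 3 p` in terms of the parent map of the labels. -/
lemma balancedUnicyclic_adj {n l p : ℕ} (hl : 1 ≤ l) (u v : Fin n) :
    (balancedUnicyclic n l 3 p).Adj u v ↔
      (u.val < 3 ∧ v.val < 3 ∧ u ≠ v) ∨ (3 ≤ v.val ∧ u.val = labelPar l p v.val) ∨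
      (3 ≤ u.val ∧ v.val = labelPar l p u.val) := by
  have key : ∀ a b : ℕ, ((a + 1 = b ∧ b < 3) ∨ (a = 0 ∧ b + 1 = 3) ∨
      (b = 3 ∧ 1 ≤ p ∧ a = 0) ∨ (3 < b ∧ b < 3 + p ∧ a + 1 = b) ∨
      (3 + p ≤ b ∧ b < 3 + p + l ∧ a = if p = 0 then 0 else 3 + p - 1) ∨
      (3 + p + l ≤ b ∧ a + l = b)) ↔
      (b < 3 ∧ a < b) ∨ (3 ≤ b ∧ a = labelPar l p b) := by
    intro a b
    simp only [labelPar]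
    split_ifs <;> omega
  rw [balancedUnicyclic, fromRel_adj, key, key]
  have hlt : ∀ b, 3 ≤ b → labelPar l p b < b := by
    intro b hb
    simp only [labelPar]
    split_ifs <;> omega
  rw [Ne, Fin.ext_iff]
  have h1 := hlt u
  have h2 := hlt v
  omega

/-- The graph `balancedUnicyclic n l 3 p` is a triangle with a balanced broom at one of its
vertices. -/
theorem balancedUnicyclic_iso {n l p : ℕ} (hl : 1 ≤ l) (hn : 3 + p + l ≤ n) :
    Nonempty (balancedUnicyclic n l 3 p ≃g
      triGraph (chain p (paths (balancedParts l (n - 3 - p)))) nil nil) := by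
  set m := n - 3 - p with hm
  set as := balancedParts l m
  set F := chain p (paths as) with hF
  obtain ⟨g1, g2⟩ := pathsLabel_spec l (3 + p) (partLen l m) m
    (fun k hk => partLen_lt (by omega) hk) l 0 (by omega)
  set g := pathsLabel l (3 + p) 0 as with hg
  obtain ⟨h1, h2, h3, h4, h5⟩ := chainLabel_spec g l p n g1
    (fun x => by
      obtain ⟨i, j, -, -, h, -⟩ := g2 x
      rw [show g x = 3 + p + i + l * j from h]; omega)
    (fun x => by
      obtain ⟨i, j, -, -, h, h', -⟩ := g2 x
      rw [show g x = 3 + p + i + l * j from h]; omega)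
    (by omega)
    (fun x hx => by
      obtain ⟨i, j, -, hi, h, h', h'', -⟩ := g2 x
      obtain rfl := h'' hx
      rw [show g x = 3 + p + i + l * 0 from h, labelPar, if_neg (by omega), if_pos (by omega)])
    (fun x y hxy => by
      obtain ⟨i, j, -, hi, h, h', -, h''⟩ := g2 x
      obtain ⟨j, rfl, hy⟩ := h'' y hxy
      rw [show g x = 3 + p + i + l * (j + 1) from h, show g y = 3 + p + i + l * j from hy, mul_add,
        labelPar, if_neg (by omega), if_neg (by omega)]
      omega)
    p 3 le_rfl rfl
  set L : F.Vert → ℕ := chainLabel g p 3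
  let φ : Fin 3 ⊕ F.Vert → Fin n := Sum.elim (fun i => ⟨i, by omega⟩) fun x => ⟨L x, h3 x⟩
  have hφ : φ.Bijective := by
    rw [Fintype.bijective_iff_injective_and_card]
    constructor
    · rintro (i | x) (j | y) h
      · have : (φ (.inl i)).val = (φ (.inl j)).val := congrArg Fin.val h
        rw [Fin.ext (show i.val = j.val from this)]
      · have : i.val = L y := congrArg Fin.val h
        have := h2 y; omega
      · have : L x = j.val := congrArg Fin.val h
        have := h2 x; omega
      · have : L x = L y := congrArg Fin.val h
        rw [h1 this]
    · have : as.sum + l = m := sum_balancedParts hl (by omega)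
      rw [Fintype.card_sum, Fintype.card_fin, Fintype.card_fin, card_vert, hF, size_chain,
        size_paths, length_balancedParts]
      omega
  have e : (⊤ : SimpleGraph (Fin 3)).hang 0 F ≃g balancedUnicyclic n l 3 p := by
    refine ⟨Equiv.ofBijective φ hφ, ?_⟩
    intro a b
    change (balancedUnicyclic n l 3 p).Adj (φ a) (φ b) ↔ _
    rw [balancedUnicyclic_adj hl]
    have hLpar : ∀ (x y : F.Vert), L y = labelPar l p (L x) ↔ par x = some y := by
      intro x y
      cases hx : par x with
      | none =>
        have := h2 y
        rw [h4 x hx, if_pos rfl]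
        exact ⟨fun h => by omega, fun h => by cases h⟩
      | some z =>
        rw [h5 x z hx, h1.eq_iff, Option.some.injEq, eq_comm]
    have hLpar' : ∀ (x : F.Vert) (i : Fin 3),
        i.val = labelPar l p (L x) ↔ i = 0 ∧ par x = none := by
      intro x i
      cases hx : par x with
      | none => rw [h4 x hx, if_pos rfl, Fin.ext_iff]; exact ⟨fun h => ⟨h, rfl⟩, fun h => h.1⟩
      | some z =>
        have := h2 z
        rw [h5 x z hx]
        exact ⟨fun h => by omega, fun h => by cases h.2⟩
    rcases a with (i | x) <;> rcases b with (j | y)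
    · have hi := i.isLt
      have hj := j.isLt
      simp only [φ, Sum.elim_inl, hang_inl_inl, top_adj, Ne, Fin.ext_iff]
      omega
    · rw [hang_inl_inr, ← hLpar' y i]
      simp only [φ, Sum.elim_inl, Sum.elim_inr]
      have := h2 y
      omega
    · rw [hang_inr_inl, ← hLpar' x j]
      simp only [φ, Sum.elim_inl, Sum.elim_inr]
      have := h2 x
      omega
    · rw [hang_inr_inr, ← hLpar, ← hLpar]
      simp only [φ, Sum.elim_inr]
      have := h2 x
      have := h2 y
      omega
  exact ⟨e.symm.trans ((hangNil _ _).trans (hangNil _ _)).symm⟩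

end SimpleGraph

/-! ### Comparison of the balanced brooms -/

namespace Forest

/-- The broom with handle of length `i` and `l` balanced bristles that hangs at the triangle in
`balancedUnicyclic n l 3 i`. -/
def broom (n l i : ℕ) : Forest := chain i (paths (balancedParts l (n - 3 - i)))

lemma broom_spec {n l i : ℕ} (hl : 1 ≤ l) (hi : 3 + i + l ≤ n) :
    3 + (broom n l i).size = n ∧ (broom n l i).leaves = l := by
  have h1 := length_balancedParts l (n - 3 - i)
  have h2 := sum_balancedParts (l := l) (m := n - 3 - i) hl (by omega)
  rw [broom, leaves_chain, leaves_paths, h1, size_chain, size_paths, h1]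
  · exact ⟨by omega, rfl⟩
  · exact paths_ne_nil (by intro h; rw [h] at h1; simp at h1; omega)

/-- With a single bristle all brooms are paths. -/
lemma broom_one {n i : ℕ} (hi : 4 + i ≤ n) : broom n 1 i = chain (n - 3) nil := by
  obtain ⟨a, ha⟩ := List.length_eq_one_iff.1 (length_balancedParts 1 (n - 3 - i))
  have h := (broom_spec (n := n) (l := 1) (i := i) le_rfl (by omega)).1
  have hb : broom n 1 i = chain (i + (a + 1)) nil := by
    rw [broom, ha, chain_add]; rfl
  rw [hb, size_chain, size] at h
  rw [hb]; congr 1; omega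

/-- One step along the list of balanced brooms lowers the coefficient of `X ^ 2`, raises that of
`X ^ (n - 2 - 2 * p)`, and keeps the higher ones. -/
lemma coeff_broom_succ {n l p : ℕ} (hl : 2 ≤ l) (hp : (l + 1) * (p + 1) + 2 * l + 3 ≤ n) :
    (uniPoly (broom n l (p + 1))).coeff 2 < (uniPoly (broom n l p)).coeff 2 ∧
    (uniPoly (broom n l p)).coeff (n - 2 - 2 * p) <
      (uniPoly (broom n l (p + 1))).coeff (n - 2 - 2 * p) ∧
    ∀ k, n - 2 - 2 * p < k →
      (uniPoly (broom n l (p + 1))).coeff k = (uniPoly (broom n l p)).coeff k := by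
  have hp' : l * (p + 3) + p + 4 ≤ n := by nlinarith
  have hlp : l ≤ l * (p + 3) := Nat.le_mul_of_pos_right l (by omega)
  set as := balancedParts l (n - 3 - (p + 1)) with has
  have hlen : as.length = l := length_balancedParts _ _
  have hsum : as.sum + l = n - 3 - (p + 1) := sum_balancedParts (by omega) (by omega)
  obtain ⟨b, as', hperm, hmin⟩ := exists_min_perm (as := as) (by
    intro h; rw [h] at hlen; simp at hlen; omega)
  have hlen' := hperm.length_eq
  have hsum' := hperm.sum_eq
  have hbal : Balanced (b :: as') := (balanced_balancedParts _ _).perm hperm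
  have hb := (hbal.min_mul hmin).2
  simp only [List.length_cons, List.sum_cons] at hlen' hsum' hb
  have hb' : p + 3 ≤ b + 1 := by
    have h1 : l * (p + 3) < (b + 2) * l := by
      rw [← hlen', hlen] at hb
      have : (b + 2) * l = (b + 1) * l + l := by ring
      omega
    rw [mul_comm] at h1
    have := lt_of_mul_lt_mul_right h1 (by omega)
    omega
  have hperm2 : ((b + 1) :: as').Perm (balancedParts l (n - 3 - p)) := by
    refine Balanced.perm_of_sum_eq (hbal.incr_min hmin) (balanced_balancedParts _ _) ?_ ?_
    · rw [length_balancedParts, List.length_cons]; omega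
    · have := sum_balancedParts (l := l) (m := n - 3 - p) (by omega) (by omega)
      rw [List.sum_cons]; omega
  have hY : paths as' ≠ nil := paths_ne_nil (by rintro rfl; simp at hlen'; omega)
  have e1 : uniPoly (broom n l (p + 1)) =
      uniPoly (chain (p + 1) (cons (chain b nil) (paths as'))) := by
    have := ((Equiv.paths hperm).chain (p + 1)).invariants
    rw [broom, uniPoly, uniPoly, tot, tot, this.1, this.2.1]; rfl
  have e2 : uniPoly (broom n l p) = uniPoly (chain p (cons (chain (b + 1) nil) (paths as'))) := by
    have := ((Equiv.paths hperm2).chain p).invariants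
    rw [broom, uniPoly, uniPoly, tot, tot, ← this.1, ← this.2.1]; rfl
  obtain ⟨h1, h2, h3⟩ := coeff_center_move p (b + 1 - p) b (by omega) (by omega) hY rfl
  rw [← e1, ← e2] at h1 h2 h3
  have hs : (paths as').size + (b + 1 - p) + 2 = n - 2 - 2 * p := by
    rw [size_paths]; omega
  rw [hs] at h2 h3
  simp only [coeff_sub] at h1 h2 h3
  exact ⟨by linarith, by linarith, fun k hk => by linarith [h3 k hk]⟩

/-- Comparison of any two brooms of the list. The exponent in `coeff_broom_succ` decreases along
the list, so later steps keep the coefficient that the first step has raised. -/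
lemma coeff_broom_lt {n l i : ℕ} (hl : 2 ≤ l) (d : ℕ)
    (hj : (l + 1) * (i + d + 1) + 2 * l + 3 ≤ n) :
    (uniPoly (broom n l (i + d + 1))).coeff 2 < (uniPoly (broom n l i)).coeff 2 ∧
    (uniPoly (broom n l i)).coeff (n - 2 - 2 * i) <
      (uniPoly (broom n l (i + d + 1))).coeff (n - 2 - 2 * i) := by
  induction d with
  | zero => exact ⟨(coeff_broom_succ hl hj).1, (coeff_broom_succ hl hj).2.1⟩
  | succ d ih =>
    obtain ⟨h1, h2⟩ := ih (by nlinarith)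
    obtain ⟨h3, -, h4⟩ := coeff_broom_succ (p := i + d + 1) hl hj
    have : 3 * (i + (d + 1) + 1) ≤ (l + 1) * (i + (d + 1) + 1) :=
      Nat.mul_le_mul_right _ (by omega)
    refine ⟨h3.trans h1, ?_⟩
    rw [show i + (d + 1) + 1 = i + d + 1 + 1 by ring, h4 _ (by omega)]
    exact h2

end Forest

namespace SimpleGraph

/-- With two empty forests, only one forest hangs at the triangle. -/
def triGraphSingle (F : Forest) : triGraph F nil nil ≃g (⊤ : SimpleGraph (Fin 3)).hang 0 F :=
  (hangNil _ _).trans (hangNil _ _)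

lemma triGraph_perm (F : Forest) : Nonempty (triGraph nil F nil ≃g triGraph F nil nil) ∧
    Nonempty (triGraph nil nil F ≃g triGraph F nil nil) := by
  constructor
  · refine ⟨((hangNil _ _).trans ((hangCongr (hangNil _ _) rfl F).trans
      (hangCongr (Iso.completeGraph (Equiv.swap 0 1)) ?_ F))).trans (triGraphSingle F).symm⟩
    rfl
  · refine ⟨((hangCongr ((hangNil _ _).trans (hangNil _ _)) rfl F).trans
      (hangCongr (Iso.completeGraph (Equiv.swap 0 2)) ?_ F)).trans (triGraphSingle F).symm⟩
    rfl

lemma lapCoeff_iso {n : ℕ} {G H : SimpleGraph (Fin n)} (e : G ≃g H) {k : ℕ} (hk : k ≤ n) :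
    lapCoeff G k = lapCoeff H k := by
  rw [lapCoeff_eq _ (by simpa using hk), lapCoeff_eq _ (by simpa using hk), lapPoly_iso e]

/-- A triangle with forests that has a smaller polynomial excludes minimality. -/
lemma not_polyLT_of_minimal {n l : ℕ} {G : SimpleGraph (Fin n)}
    (hG : IsLapMinimal (unicyclicGraphs n l 3) G) {F₁ F₂ F₃ E₁ E₂ E₃ : Forest}
    (e : G ≃g triGraph F₁ F₂ F₃) (hs : 3 + E₁.size + E₂.size + E₃.size = n)
    (hl : E₁.leaves + E₂.leaves + E₃.leaves = l) :
    ¬ PolyLT (triPoly E₁ E₂ E₃) (triPoly F₁ F₂ F₃) := by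
  rintro ⟨h1, h2⟩
  obtain ⟨H, ⟨e'⟩⟩ := exists_iso_fin_triGraph hs
  have hdegG : (triPoly F₁ F₂ F₃).natDegree = n := by
    rw [← lapPoly_triGraph, ← lapPoly_iso e, natDegree_lapPoly, Fintype.card_fin]
  have hdegH : (triPoly E₁ E₂ E₃).natDegree = n := by
    rw [← lapPoly_triGraph, ← lapPoly_iso e', natDegree_lapPoly, Fintype.card_fin]
  have hle : LapLE H G := fun k hk => by
    rw [lapCoeff_of_iso e hk, lapCoeff_of_iso e' hk]
    have := h1 (n - k)
    rw [coeff_sub] at this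
    linarith
  refine hG.2 H (mem_of_iso_triGraph e' hl) ⟨hle, ?_⟩
  by_contra! hcon
  have hzero : triPoly F₁ F₂ F₃ - triPoly E₁ E₂ E₃ = 0 := by
    ext j
    rw [coeff_sub, coeff_zero]
    by_cases hj : j ≤ n
    · have h3 := hcon (n - j) (by omega)
      rw [lapCoeff_of_iso e (by omega), lapCoeff_of_iso e' (by omega),
        show n - (n - j) = j by omega] at h3
      have := h1 j
      rw [coeff_sub] at this
      linarith
    · rw [coeff_eq_zero_of_natDegree_lt (by omega), coeff_eq_zero_of_natDegree_lt (by omega),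
        sub_zero]
  rw [hzero] at h2
  simp at h2

/-- In a minimal graph only one vertex of the triangle carries a forest. -/
lemma exists_single_forest {n l : ℕ} {G : SimpleGraph (Fin n)}
    (hG : IsLapMinimal (unicyclicGraphs n l 3) G) :
    ∃ F, Nonempty (G ≃g triGraph F nil nil) ∧ 3 + F.size = n ∧ F.leaves = l := by
  obtain ⟨F₁, F₂, F₃, ⟨e⟩, hs, hlv⟩ := exists_triGraph_of_mem hG.1
  have h12 : F₁ = nil ∨ F₂ = nil := by
    by_contra! h
    refine not_polyLT_of_minimal hG e (E₁ := F₁.append F₂) (E₂ := nil) (E₃ := F₃) ?_ ?_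
      (triPoly_merge_lt h.1 h.2 F₃)
    · rw [size_append, size]; omega
    · rw [leaves_append, leaves]; omega
  have h13 : F₁ = nil ∨ F₃ = nil := by
    by_contra! h
    refine not_polyLT_of_minimal hG e (E₁ := F₁.append F₃) (E₂ := nil) (E₃ := F₂) ?_ ?_ ?_
    · rw [size_append, size]; omega
    · rw [leaves_append, leaves]; omega
    · rw [triPoly_swap_right F₁ F₂]; exact triPoly_merge_lt h.1 h.2 F₂
  have h23 : F₂ = nil ∨ F₃ = nil := by
    by_contra! h
    refine not_polyLT_of_minimal hG e (E₁ := F₂.append F₃) (E₂ := nil) (E₃ := F₁) ?_ ?_ ?_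
    · rw [size_append, size]; omega
    · rw [leaves_append, leaves]; omega
    · rw [triPoly_swap_left F₁ F₂, triPoly_swap_right F₂ F₁]
      exact triPoly_merge_lt h.1 h.2 F₁
  by_cases h1 : F₁ = nil
  · by_cases h2 : F₂ = nil
    · subst h1 h2
      obtain ⟨e'⟩ := (triGraph_perm F₃).2
      exact ⟨F₃, ⟨e.trans e'⟩, by simpa [size] using hs, by simpa [leaves] using hlv⟩
    · obtain rfl := h23.resolve_left h2
      subst h1
      obtain ⟨e'⟩ := (triGraph_perm F₂).1
      exact ⟨F₂, ⟨e.trans e'⟩, by simpa [size] using hs, by simpa [leaves] using hlv⟩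
  · obtain rfl := h12.resolve_left h1
    obtain rfl := h13.resolve_left h1
    exact ⟨F₁, ⟨e⟩, by simpa [size] using hs, by simpa [leaves] using hlv⟩

/-- A minimal graph is a triangle with a balanced broom. Unless the handle is empty, each bristle
exceeds it by at least two vertices, by `center_move_lt`; in numbers,
`(l + 1) * i + 2 * l + 3 ≤ n`. -/
lemma exists_broom_of_minimal {n l : ℕ} (hl : 1 ≤ l) {G : SimpleGraph (Fin n)}
    (hG : IsLapMinimal (unicyclicGraphs n l 3) G) :
    ∃ i, (i = 0 ∨ (l + 1) * i + 2 * l + 3 ≤ n) ∧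
      Nonempty (G ≃g triGraph (broom n l i) nil nil) := by
  obtain ⟨F, ⟨e⟩, hs, hlv⟩ := exists_single_forest hG
  have hnot : ∀ E : Forest, E.size = F.size → E.leaves = F.leaves →
      ¬ PolyLT (uniPoly E) (uniPoly F) := by
    intro E h1 h2
    rw [← triPoly_nil_nil, ← triPoly_nil_nil]
    exact not_polyLT_of_minimal hG e (by simp only [size]; omega) (by simp only [leaves]; omega)
  have hnot' : ¬ Improvable F := by
    rintro ⟨E, h1, h2, h3⟩
    exact hnot E h1 h2 h3.uniPoly_lt
  have hF : F ≠ nil := by rintro rfl; simp [leaves] at hlv; omega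
  obtain ⟨p, as, hequiv, hne, hp⟩ := (improvable_or_broom F hF).resolve_left hnot'
  have hbal : Balanced as := by
    by_contra h
    exact hnot' (((improvable_of_not_balanced h).chain p).of_equiv hequiv)
  obtain ⟨i1, i2, i3, i4⟩ := hequiv.invariants
  rw [size_chain, size_paths] at i3
  rw [leaves_chain _ (paths_ne_nil hne), leaves_paths] at i4
  refine ⟨p, ?_, ?_⟩
  · rcases p with _ | p
    · exact .inl rfl
    right
    obtain ⟨b, as', hperm, hmin⟩ := exists_min_perm hne
    have hsum := hperm.sum_eq
    have hlen := hperm.length_eq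
    have hbm := ((hbal.perm hperm).min_mul hmin).1
    simp only [List.length_cons, List.sum_cons] at hlen hsum hbm
    -- otherwise the move of the center towards the triangle gives a smaller member
    have hb : p + 2 ≤ b := by
      by_contra! hb
      have hY : paths as' ≠ nil := paths_ne_nil (by rintro rfl; simp at hlen; omega)
      have hc := ((Equiv.paths hperm).chain (p + 1)).invariants
      refine hnot (chain p (paths ((b + 1) :: as'))) ?_ ?_ ?_
      · rw [size_chain, size_paths, List.sum_cons, List.length_cons]; omega
      · rw [leaves_chain _ (paths_ne_nil (by simp)), leaves_paths, List.length_cons]; omega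
      · have := center_move_lt p b (by omega) hY
        have hu : uniPoly F = uniPoly (chain (p + 1) (paths (b :: as'))) := by
          rw [uniPoly, uniPoly, tot, tot, i1, i2, hc.1, hc.2.1]
        rw [hu]; exact this
    have h1 : (p + 2) * l ≤ b * (as'.length + 1) := by
      rw [← hlen, ← i4, hlv]; exact Nat.mul_le_mul_right _ hb
    have h2 : (l + 1) * (p + 1) = (p + 2) * l + p + 1 - l := by
      have : (p + 2) * l = (p + 1) * l + l := by ring
      have h3 : (l + 1) * (p + 1) = (p + 1) * l + (p + 1) := by ring
      omega
    have h4 : (p + 2) * l = (p + 1) * l + l := by ring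
    omega
  · have hperm : as.Perm (balancedParts l (n - 3 - p)) := by
      have hlen : as.length = l := by omega
      have hl2 : l ≤ n - 3 - p := by omega
      have := sum_balancedParts hl hl2
      refine hbal.perm_of_sum_eq (balanced_balancedParts _ _) ?_ (by omega)
      rw [length_balancedParts, hlen]
    obtain ⟨e'⟩ := hang_equiv (G := (⊤ : SimpleGraph (Fin 3))) (v := 0)
      (hequiv.trans ((Equiv.paths hperm).chain p))
    exact ⟨e.trans ((triGraphSingle F).trans (e'.trans (triGraphSingle _).symm))⟩

end SimpleGraph

open SimpleGraph

lemma LapLT.trans {n : ℕ} {G H K : SimpleGraph (Fin n)} (h : LapLT G H) (h' : LapLT H K) :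
    LapLT G K := by
  obtain ⟨h1, k, hk, h2⟩ := h
  exact ⟨fun k hk => (h1 k hk).trans (h'.1 k hk), k, hk, h2.trans_le (h'.1 k hk)⟩

lemma LapLT.irrefl {n : ℕ} (G : SimpleGraph (Fin n)) : ¬ LapLT G G :=
  fun ⟨_, _, _, h⟩ => lt_irrefl _ h

/-- As there are finitely many graphs, below every member that is not minimal there is a minimal
one. -/
lemma exists_lapMinimal_lt {n : ℕ} {S : Set (SimpleGraph (Fin n))} {G H : SimpleGraph (Fin n)}
    (hH : H ∈ S) (h : LapLT H G) : ∃ M, IsLapMinimal S M ∧ LapLT M G := by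
  have : IsTrans (SimpleGraph (Fin n)) LapLT := ⟨fun _ _ _ => LapLT.trans⟩
  have : Std.Irrefl (α := SimpleGraph (Fin n)) LapLT := ⟨LapLT.irrefl⟩
  have hwf : WellFounded (LapLT (n := n)) := Finite.wellFounded_of_trans_of_irrefl _
  obtain ⟨M, ⟨h1, h2⟩, h3⟩ := hwf.has_min {M | M ∈ S ∧ LapLT M G} ⟨H, hH, h⟩
  exact ⟨M, ⟨h1, fun K hK hKM => h3 K ⟨hK, hKM.trans h2⟩ hKM⟩, h2⟩

theorem theorem4p3 (n l : ℕ) (hl : 1 ≤ l) (hn : l + 3 ≤ n)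
    (p : ℤ) (hp : p = max 0 ⌊((n : ℚ) - 3 - 2 * l) / (l + 1)⌋) :
    -- the minimal elements are, up to isomorphism, exactly the listed graphs
    (∀ i : ℕ, (i : ℤ) ≤ p →
      IsLapMinimal (unicyclicGraphs n l 3) (balancedUnicyclic n l 3 i)) ∧
    (∀ G : SimpleGraph (Fin n), IsLapMinimal (unicyclicGraphs n l 3) G →
      ∃ i : ℕ, (i : ℤ) ≤ p ∧ Nonempty (G ≃g balancedUnicyclic n l 3 i)) ∧
    -- the listed graphs are pairwise distinct, as graphs and as elements of the poset
    (2 ≤ l → ∀ i j : ℕ, (i : ℤ) ≤ p → (j : ℤ) ≤ p → i ≠ j →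
      ¬ Nonempty (balancedUnicyclic n l 3 i ≃g balancedUnicyclic n l 3 j) ∧
      ¬ LapLE (balancedUnicyclic n l 3 i) (balancedUnicyclic n l 3 j)) := by
  have hip : ∀ i : ℕ, (i : ℤ) ≤ p ↔ i = 0 ∨ (l + 1) * i + 2 * l + 3 ≤ n := by
    intro i
    have hpos : (0 : ℚ) < (l : ℚ) + 1 := by positivity
    rw [hp, le_max_iff, Int.le_floor, le_div_iff₀ hpos]
    refine or_congr (by omega) ?_
    rw [← Nat.cast_le (α := ℚ)]
    push_cast
    constructor <;> intro h <;> linarith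
  have hin : ∀ i : ℕ, (i : ℤ) ≤ p → 3 + i + l ≤ n := by
    intro i hi
    rcases (hip i).1 hi with rfl | h
    · omega
    · nlinarith
  have hiso : ∀ i : ℕ, (i : ℤ) ≤ p →
      Nonempty (balancedUnicyclic n l 3 i ≃g triGraph (broom n l i) nil nil) :=
    fun i hi => balancedUnicyclic_iso hl (hin i hi)
  have hcoeff : ∀ i : ℕ, (i : ℤ) ≤ p → ∀ k ≤ n, lapCoeff (balancedUnicyclic n l 3 i) k =
      (uniPoly (broom n l i)).coeff (n - k) := by
    intro i hi k hk
    obtain ⟨e⟩ := hiso i hi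
    rw [lapCoeff_of_iso e hk, triPoly_nil_nil]
  have hmin : ∀ G : SimpleGraph (Fin n), IsLapMinimal (unicyclicGraphs n l 3) G →
      ∃ i : ℕ, (i : ℤ) ≤ p ∧ Nonempty (G ≃g balancedUnicyclic n l 3 i) := by
    intro G hG
    obtain ⟨i, hi, ⟨e⟩⟩ := exists_broom_of_minimal hl hG
    have hi' := (hip i).2 hi
    obtain ⟨e'⟩ := hiso i hi'
    exact ⟨i, hi', ⟨e.trans e'.symm⟩⟩
  have hnle : 2 ≤ l → ∀ i j : ℕ, (i : ℤ) ≤ p → (j : ℤ) ≤ p → i ≠ j →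
      ¬ LapLE (balancedUnicyclic n l 3 i) (balancedUnicyclic n l 3 j) := by
    intro hl2 i j hi hj hij hle
    rcases lt_or_gt_of_ne hij with h | h
    -- the graph with the longer handle has the smaller coefficient of `X ^ 2`
    · obtain ⟨d, rfl⟩ : ∃ d, j = i + d + 1 := ⟨j - i - 1, by omega⟩
      have h1 := (coeff_broom_lt hl2 d (((hip _).1 hj).resolve_left (by omega))).1
      have h2 := hle (n - 2) (by omega)
      rw [hcoeff i hi _ (by omega), hcoeff _ hj _ (by omega), show n - (n - 2) = 2 by omega] at h2
      linarith
    -- and the larger coefficient of `X ^ (n - 2 - 2 * j)`, if the shorter handle has length `j`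
    · obtain ⟨d, rfl⟩ : ∃ d, i = j + d + 1 := ⟨i - j - 1, by omega⟩
      have hb := ((hip _).1 hi).resolve_left (by omega)
      have h1 := (coeff_broom_lt hl2 d hb).2
      have h3 : 3 * (j + d + 1) ≤ (l + 1) * (j + d + 1) := Nat.mul_le_mul_right _ (by omega)
      have h2 := hle (2 + 2 * j) (by omega)
      rw [hcoeff _ hi _ (by omega), hcoeff j hj _ (by omega),
        show n - (2 + 2 * j) = n - 2 - 2 * j by omega] at h2
      linarith
  refine ⟨fun i hi => ⟨?_, fun H hH hlt => ?_⟩, hmin,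
    fun hl2 i j hi hj hij => ⟨?_, hnle hl2 i j hi hj hij⟩⟩
  · obtain ⟨e⟩ := hiso i hi
    exact mem_of_iso_triGraph e (by simp [leaves, (broom_spec hl (hin i hi)).2])
  · obtain ⟨M, hM, hMlt⟩ := exists_lapMinimal_lt hH hlt
    obtain ⟨j, hj, ⟨e⟩⟩ := hmin M hM
    have hlt' : LapLT (balancedUnicyclic n l 3 j) (balancedUnicyclic n l 3 i) := by
      obtain ⟨h1, k, hk, h2⟩ := hMlt
      exact ⟨fun k hk => (lapCoeff_iso e hk) ▸ h1 k hk, k, hk, (lapCoeff_iso e hk) ▸ h2⟩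
    by_cases hij : j = i
    · subst hij
      exact LapLT.irrefl _ hlt'
    · by_cases hl2 : 2 ≤ l
      · exact hnle hl2 j i hj hi hij hlt'.1
      -- with one leaf, all graphs of the list are isomorphic
      · obtain rfl : l = 1 := by omega
        obtain ⟨-, k, hk, h⟩ := hlt'
        rw [hcoeff j hj k hk, hcoeff i hi k hk, broom_one (by have := hin j hj; omega),
          broom_one (by have := hin i hi; omega)] at h
        exact lt_irrefl _ h
  · rintro ⟨e⟩
    exact hnle hl2 i j hi hj hij fun k hk => (lapCoeff_iso e hk).le
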